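/- Let $f\in\mathbb{R}[\theta_1,\dots,\theta_d]$ be a homogeneous polynomial of degree $p$ that is hyperbolic with respect to $\tau\in\mathbb{R}^d$, i.e. $f(\tau)\neq 0$ and for every $v\in\mathbb{R}^d$ the univariate polynomial $t\mapsto f(v+t\tau)$ has $p$ real roots counted with multiplicity. Let $C\subset\mathbb{R}^d$ be its hyperbolicity cone, i.e. the connected component of $\mathbb{R}^d\setminus\{f=0\}$ containing $\tau$, and assume that $f$ is complete, i.e. the closed cone $\overline{C}$ is pointed: $\overline{C}\cap(-\overline{C})=\{0\}$. Let $F=-\nabla\log f=-\frac{1}{f}\left(\frac{\partial f}{\partial\theta_1},\dots,\frac{\partial f}{\partial\theta_d}\right)$ be the gradient map, and let $\mathcal{L}\subset\mathbb{R}^d$ be a linear subspace with $C\cap\mathcal{L}\neq\emptyset$. Then the exponential variety $\mathcal{L}^F=\overline{F(C\cap\mathcal{L})}$ (Zariski closure) has the same dimension as $\mathcal{L}$. That is: the Zariski closure of $F(C\cap\mathcal{L})$ in the affine space $\mathbb{R}^d$ has dimension $\dim_{\mathbb{R}}\mathcal{L}$; and, if $d\geq 1$, the Zariski closure of the image of $F(C\cap\mathcal{L})$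 in the complex projective space $\mathbb{CP}^{d-1}$ has dimension $\dim_{\mathbb{R}}\mathcal{L}-1$, the dimension of the projectivization of $\mathcal{L}$. (Dimension is the Krull dimension of the Zariski topology, i.e. the supremum of the lengths of chains of irreducible closed subsets.) -/

import Mathlib

open MvPolynomial
open scoped LinearAlgebra.Projectivization

noncomputable section

namespace ExpVar

/-! ### Hyperbolic polynomials -/

/-- The univariate polynomial `t ↦ f (v + t τ)`. -/
def alongLine {d : ℕ} (f : MvPolynomial (Fin d) ℝ) (τ v : Fin d → ℝ) : Polynomial ℝ :=
  aeval (fun i => Polynomial.C (v i) + Polynomial.C (τ i) * Polynomial.X) f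

/-- `f` is homogeneous of degree `p`, does not vanish at `τ`, and every line in direction `τ`
(that is, every line through the point `τ` of projective space) meets `{f = 0}` in `p` real points,
counted with multiplicity. -/
structure IsHyperbolic {d : ℕ} (f : MvPolynomial (Fin d) ℝ) (p : ℕ) (τ : Fin d → ℝ) : Prop where
  homogeneous : f.IsHomogeneous p
  ne_zero : eval τ f ≠ 0
  real_rooted : ∀ v : Fin d → ℝ, (alongLine f τ v).roots.card = p

/-- The hyperbolicity cone: the connected component of `ℝ^d \ {f = 0}` (in the Euclidean topology)
that contains `τ`. -/
def hyperbolicityCone {d : ℕ} (f : MvPolynomial (Fin d) ℝ) (τ : Fin d → ℝ) : Set (Fin d → ℝ) :=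
  connectedComponentIn {θ | eval θ f ≠ 0} τ

/-- `f` is complete (with respect to `τ`): its closed hyperbolicity cone is pointed. -/
def IsComplete {d : ℕ} (f : MvPolynomial (Fin d) ℝ) (τ : Fin d → ℝ) : Prop :=
  closure (hyperbolicityCone f τ) ∩ -closure (hyperbolicityCone f τ) = {0}

/-- The gradient map `F = -∇ log f = -(∇ f) / f`. -/
def gradientMap {d : ℕ} (f : MvPolynomial (Fin d) ℝ) (θ : Fin d → ℝ) : Fin d → ℝ :=
  fun i => -(eval θ (pderiv i f) / eval θ f)

/-! ### Zariski topologies and dimension -/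

/-- The set of common zeros in affine space `K^d`. -/
def affineZeros {K : Type*} [Field K] {d : ℕ} (S : Set (MvPolynomial (Fin d) K)) :
    Set (Fin d → K) :=
  {x | ∀ g ∈ S, eval x g = 0}

/-- The Zariski topology on affine space `K^d`. -/
abbrev affineZariski (K : Type*) [Field K] (d : ℕ) : TopologicalSpace (Fin d → K) :=
  TopologicalSpace.ofClosed {Z | ∃ S : Set (MvPolynomial (Fin d) K), Z = affineZeros S}
    ⟨{1}, by ext x; simp [affineZeros]⟩
    (by
      intro A hA
      refine ⟨{g | ∃ S, affineZeros S ∈ A ∧ g ∈ S}, ?_⟩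
      ext x
      constructor
      · rintro hx g ⟨S, hS, hg⟩
        exact hx _ hS g hg
      · intro hx Z hZ
        obtain ⟨S, rfl⟩ := hA hZ
        exact fun g hg => hx g ⟨S, hZ, hg⟩)
    (by
      rintro _ ⟨S, rfl⟩ _ ⟨T, rfl⟩
      refine ⟨{g | ∃ a ∈ S, ∃ b ∈ T, g = a * b}, ?_⟩
      ext x
      constructor
      · rintro (hx | hx) g ⟨a, ha, b, hb, rfl⟩
        · simp [hx a ha]
        · simp [hx b hb]
      · intro hx
        by_contra hcon
        simp only [affineZeros, Set.mem_union, Set.mem_ofPred_eq, not_or, not_forall] at hcon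
        obtain ⟨⟨a, ha, ha0⟩, b, hb, hb0⟩ := hcon
        have := hx (a * b) ⟨a, ha, b, hb, rfl⟩
        simp_all)

/-- The set of common zeros in projective space `ℙ(K^d)`, meant for sets of homogeneous
polynomials (for which the chosen representative `p.rep` of a point does not matter). -/
def projZeros {K : Type*} [Field K] {d : ℕ} (S : Set (MvPolynomial (Fin d) K)) :
    Set (ℙ K (Fin d → K)) :=
  {p | ∀ g ∈ S, eval p.rep g = 0}

/-- The Zariski topology on the projective space `ℙ(K^d)` of dimension `d - 1`: closed sets are the
common zero sets of homogeneous polynomials. -/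
abbrev projZariski (K : Type*) [Field K] (d : ℕ) : TopologicalSpace (ℙ K (Fin d → K)) :=
  TopologicalSpace.ofClosed
    {Z | ∃ S : Set (MvPolynomial (Fin d) K), (∀ g ∈ S, ∃ n, g.IsHomogeneous n) ∧ Z = projZeros S}
    ⟨{1}, by
      rintro g rfl
      exact ⟨0, isHomogeneous_one _ _⟩, by ext x; simp [projZeros]⟩
    (by
      intro A hA
      refine ⟨{g | (∃ n, g.IsHomogeneous n) ∧ ∃ S, projZeros S ∈ A ∧ g ∈ S}, fun g hg => hg.1, ?_⟩
      ext x
      constructor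
      · rintro hx g ⟨_, S, hS, hg⟩
        exact hx _ hS g hg
      · intro hx Z hZ
        obtain ⟨S, hS, rfl⟩ := hA hZ
        exact fun g hg => hx g ⟨hS g hg, S, hZ, hg⟩)
    (by
      rintro _ ⟨S, hS, rfl⟩ _ ⟨T, hT, rfl⟩
      refine ⟨{g | ∃ a ∈ S, ∃ b ∈ T, g = a * b}, ?_, ?_⟩
      · rintro g ⟨a, ha, b, hb, rfl⟩
        obtain ⟨m, hm⟩ := hS a ha
        obtain ⟨n, hn⟩ := hT b hb
        exact ⟨m + n, hm.mul hn⟩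
      ext x
      constructor
      · rintro (hx | hx) g ⟨a, ha, b, hb, rfl⟩
        · simp [hx a ha]
        · simp [hx b hb]
      · intro hx
        by_contra hcon
        simp only [projZeros, Set.mem_union, Set.mem_ofPred_eq, not_or, not_forall] at hcon
        obtain ⟨⟨a, ha, ha0⟩, b, hb, hb0⟩ := hcon
        have := hx (a * b) ⟨a, ha, b, hb, rfl⟩
        simp_all)

/-- The dimension of a subset `V` of a space with topology `t`: the supremum of the lengths of
chains of irreducible closed subsets of `V`, in the subspace topology. -/
def dimension {X : Type*} (t : TopologicalSpace X) (V : Set X) : WithBot ℕ∞ :=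
  @topologicalKrullDim V (t.induced Subtype.val)

/-! ### Exponential varieties -/

/-- The positive exponential variety `F(C ∩ L)` in `ℝ^d`. -/
def positivePart {d : ℕ} (f : MvPolynomial (Fin d) ℝ) (τ : Fin d → ℝ)
    (L : Submodule ℝ (Fin d → ℝ)) : Set (Fin d → ℝ) :=
  gradientMap f '' (hyperbolicityCone f τ ∩ L)

/-- The exponential variety `L^F` in affine space `ℝ^d`. -/
def affineExpVariety {d : ℕ} (f : MvPolynomial (Fin d) ℝ) (τ : Fin d → ℝ)
    (L : Submodule ℝ (Fin d → ℝ)) : Set (Fin d → ℝ) :=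
  @closure _ (affineZariski ℝ d) (positivePart f τ L)

/-- The image of a set of real vectors in complex projective space. -/
def toComplexProj {d : ℕ} (S : Set (Fin d → ℝ)) : Set (ℙ ℂ (Fin d → ℂ)) :=
  {p | ∃ x ∈ S, ∃ hx : (fun i => (x i : ℂ)) ≠ 0, p = Projectivization.mk ℂ (fun i => (x i : ℂ)) hx}

/-- The exponential variety `L^F` in complex projective space of dimension `d - 1`. -/
def projExpVariety {d : ℕ} (f : MvPolynomial (Fin d) ℝ) (τ : Fin d → ℝ)
    (L : Submodule ℝ (Fin d → ℝ)) : Set (ℙ ℂ (Fin d → ℂ)) :=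
  @closure _ (projZariski ℂ d) (toComplexProj (positivePart f τ L))

end ExpVar

end

/-! On the cone `C`, the function `-log f` is strictly convex. By Gårding's theorem `f` is
hyperbolic with respect to every `a` in `C`, so `f (a + t w) = f a * ∏ (1 - r t)` with real `r`, and
the second derivative of `-log f` at `a` in direction `w` is `∑ r ^ 2`. If this sum vanishes then
`f` is constant on the line `a + t w`, so the line stays in `C`, and pointedness of the closed cone
forces `w = 0`. Hence the Hessian of `-log f`, restricted to a `k`-dimensional space of directions,
is positive definite. The gradient map on an affine section of `C`, projected to `k` coordinates, is
then open near `a` (`IsHyperbolic.map_nhds_projectedGradient`).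

This becomes algebra as follows. The vanishing ideal of the image of a `k`-dimensional section is
the kernel of a map into `K[t_1, ..., t_k]` localized at a nonzero polynomial. It is therefore prime
with coordinate ring of transcendence degree at most `k`. Equality holds because `k` linear forms
take an open set of values on the image (`IsHyperbolic.coordTrdeg_gradientImage`).

Krull dimension is computed by regarding each Zariski topology as induced from the spectrum of the
polynomial ring, a projective point going to the prime ideal of its line. Transcendence degree drops
strictly along inclusions of primes, which bounds chains from above. A flag of sections through `a`
gives a chain attaining the bound (`topologicalKrullDim_eq_of_chain`). The offset `c` there is the
least transcendence degree of a point: 0 in the affine case, 1 in the projective case. -/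

namespace ExpVar

/-! ### Transcendence degree of prime ideals -/

/-- A surjective, non-injective homomorphism of affine domains drops the transcendence degree. -/
theorem trdeg_lt_of_surjective {K A B : Type} [Field K] [CommRing A] [IsDomain A] [Algebra K A]
    [CommRing B] [IsDomain B] [Algebra K B] [Algebra.FiniteType K B] (φ : A →ₐ[K] B)
    (hφ : Function.Surjective φ) (hker : ¬ Function.Injective φ) :
    Algebra.trdeg K B < Algebra.trdeg K A := by
  obtain ⟨s, hs⟩ := exists_isTranscendenceBasis K B
  have hfin : Finite s := by
    rw [← Cardinal.mk_lt_aleph0_iff, hs.cardinalMk_eq_trdeg]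
    exact trdeg_lt_aleph0_of_finiteType
  choose ψ hψ using hφ
  let x : s → A := fun i => ψ i
  have hx' : (fun i => φ (x i)) = ((↑) : s → B) := funext fun i => hψ i
  have hx : AlgebraicIndependent K x := .of_comp φ (by
    rw [show φ ∘ x = ((↑) : s → B) from hx']
    exact hs.1)
  by_contra hle
  rw [not_lt, ← hs.cardinalMk_eq_trdeg] at hle
  have hb := AlgebraicIndependent.isTranscendenceBasis_of_trdeg_le_of_finite hx hle
  have halg := hb.isAlgebraic
  rw [injective_iff_map_eq_zero] at hker
  push Not at hker
  obtain ⟨a, ha, ha0⟩ := hker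
  -- If the lifted basis `x` were a transcendence basis of `A`, a nonzero `a` in the kernel would
  -- divide a nonzero polynomial in `x`. That polynomial would die in `B`, where the images of `x`
  -- are independent.
  obtain ⟨r, hr0, hr⟩ := (halg.isAlgebraic a).exists_nonzero_dvd
    (mem_nonZeroDivisors_of_ne_zero ha0)
  have h1 : φ r = 0 := by
    obtain ⟨c, hc⟩ := hr
    have : φ (algebraMap _ A r) = 0 := by rw [hc, map_mul, ha, zero_mul]
    exact this
  obtain ⟨r, hr'⟩ := r
  rw [Algebra.adjoin_range_eq_range_aeval] at hr'
  obtain ⟨q, rfl⟩ := hr'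
  have h2 : aeval ((↑) : s → B) q = 0 := by
    rw [← hx', ← h1]
    exact congrArg (· q) (MvPolynomial.comp_aeval x φ).symm
  have := hs.1
  have h3 : q = 0 := (injective_iff_map_eq_zero _).1 this q h2
  subst h3
  exact hr0 (Subtype.ext (map_zero (aeval x)))

/-- The transcendence degree of the coordinate ring of an ideal. -/
noncomputable def coordTrdeg {K : Type} [Field K] {d : ℕ} (P : Ideal (MvPolynomial (Fin d) K)) : ℕ :=
  (Algebra.trdeg K (MvPolynomial (Fin d) K ⧸ P)).toNat

section CoordTrdeg

variable {K : Type} [Field K] {d : ℕ}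

theorem coordTrdeg_lt {P Q : Ideal (MvPolynomial (Fin d) K)} [P.IsPrime] [Q.IsPrime] (h : P < Q) :
    coordTrdeg Q < coordTrdeg P := by
  refine Cardinal.toNat_lt_toNat ?_ trdeg_lt_aleph0_of_finiteType
  refine trdeg_lt_of_surjective (Ideal.Quotient.factorₐ K h.le)
    (Ideal.Quotient.factor_surjective h.le) fun hinj => ?_
  obtain ⟨a, haQ, haP⟩ := Set.exists_of_ssubset h
  apply haP
  rw [SetLike.mem_coe, ← Ideal.Quotient.eq_zero_iff_mem]
  apply hinj
  rw [map_zero]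
  exact Ideal.Quotient.eq_zero_iff_mem.2 haQ

theorem le_coordTrdeg {P : Ideal (MvPolynomial (Fin d) K)} [P.IsPrime] {k : ℕ}
    (ℓ : Fin k → MvPolynomial (Fin d) K)
    (h : ∀ g : MvPolynomial (Fin k) K, aeval ℓ g ∈ P → g = 0) : k ≤ coordTrdeg P := by
  have hind : AlgebraicIndependent K (fun i => Ideal.Quotient.mkₐ K P (ℓ i)) := by
    refine (injective_iff_map_eq_zero _).2 fun g hg => h g ?_
    rw [← Ideal.Quotient.eq_zero_iff_mem, ← hg, ← Ideal.Quotient.mkₐ_eq_mk K]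
    rw [← AlgHom.comp_apply, MvPolynomial.comp_aeval]
  have := hind.cardinalMk_le_trdeg
  have h2 := Cardinal.toNat_le_toNat this trdeg_lt_aleph0_of_finiteType
  simpa [coordTrdeg] using h2

/-- The coordinate ring embeds into the localization, which is algebraic over the polynomial ring in
`k` variables. -/
theorem coordTrdeg_le {P : Ideal (MvPolynomial (Fin d) K)} {k : ℕ} (r : MvPolynomial (Fin k) K)
    (hr : r ≠ 0) (φ : MvPolynomial (Fin d) K →ₐ[K] Localization.Away r)
    (hP : RingHom.ker φ = P) : coordTrdeg P ≤ k := by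
  subst hP
  have hle : Submonoid.powers r ≤ nonZeroDivisors (MvPolynomial (Fin k) K) :=
    powers_le_nonZeroDivisors_of_noZeroDivisors hr
  have : IsDomain (Localization.Away r) := IsLocalization.isDomain_localization hle
  have : FaithfulSMul (MvPolynomial (Fin k) K) (Localization.Away r) :=
    (faithfulSMul_iff_algebraMap_injective _ _).2 (IsLocalization.injective _ hle)
  have : Algebra.IsAlgebraic (MvPolynomial (Fin k) K) (Localization.Away r) :=
    IsLocalization.isAlgebraic _ (Submonoid.powers r)
  have h1 := trdeg_add_eq K (MvPolynomial (Fin k) K) (A := Localization.Away r)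
  rw [trdeg_eq_zero (R := MvPolynomial (Fin k) K), add_zero, MvPolynomial.trdeg_of_isDomain] at h1
  have h2 := trdeg_le_of_injective (Ideal.kerLiftAlg φ) (Ideal.kerLiftAlg_injective φ)
  rw [← h1] at h2
  have := Cardinal.toNat_le_toNat h2 (by simp)
  simpa [coordTrdeg] using this

end CoordTrdeg

/-! ### Spaces inducing into a prime spectrum -/

section Inducing

open TopologicalSpace Topology PrimeSpectrum

theorem isIrreducible_of_image {X Y : Type*} [TopologicalSpace X] [TopologicalSpace Y] {φ : X → Y}
    (hφ : IsInducing φ) {S : Set X} (h : IsIrreducible (φ '' S)) : IsIrreducible S := by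
  refine ⟨h.1.of_image, ?_⟩
  intro u v hu hv
  obtain ⟨u, hu', rfl⟩ := hφ.isOpen_iff.1 hu
  obtain ⟨v, hv', rfl⟩ := hφ.isOpen_iff.1 hv
  rintro ⟨x, hxS, hxu⟩ ⟨y, hyS, hyv⟩
  obtain ⟨_, ⟨z, hzS, rfl⟩, hz⟩ := h.2 u v hu' hv' ⟨_, ⟨x, hxS, rfl⟩, hxu⟩ ⟨_, ⟨y, hyS, rfl⟩, hyv⟩
  exact ⟨z, hzS, hz⟩

variable {X A : Type} [TopologicalSpace X] [CommRing A] {φ : X → PrimeSpectrum A}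

theorem vanishingIdeal_image_closure (hφ : IsInducing φ) (S : Set X) :
    vanishingIdeal (φ '' closure S) = vanishingIdeal (φ '' S) := by
  apply le_antisymm (PrimeSpectrum.vanishingIdeal_anti_mono (Set.image_mono subset_closure))
  rw [← vanishingIdeal_closure (φ '' S)]
  exact PrimeSpectrum.vanishingIdeal_anti_mono (image_closure_subset_closure_image hφ.continuous)

/-- Since the topology is induced, a closed set is the preimage of the zero locus of its vanishing
ideal, so the ideal determines it. -/
theorem vanishingIdeal_image_lt (hφ : IsInducing φ) {S T : Set X} (hS : IsClosed S) (h : S < T) :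
    vanishingIdeal (φ '' T) < vanishingIdeal (φ '' S) := by
  refine lt_of_le_not_ge (PrimeSpectrum.vanishingIdeal_anti_mono (Set.image_mono h.le)) fun hle => h.not_ge ?_
  intro x hx
  rw [← hS.closure_eq, hφ.closure_eq_preimage_closure_image, Set.mem_preimage,
    ← zeroLocus_vanishingIdeal_eq_closure, mem_zeroLocus]
  intro a ha
  exact (mem_vanishingIdeal _ _).1 (hle ha) _ ⟨x, hx, rfl⟩

theorem krullDim_fin (m : ℕ) : Order.krullDim (Fin (m + 1)) = m := by
  apply le_antisymm
  · refine iSup_le fun s => ?_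
    have := Fintype.card_le_of_injective s s.strictMono.injective
    rw [Fintype.card_fin, Fintype.card_fin] at this
    exact_mod_cast Nat.succ_le_succ_iff.1 this
  · exact le_iSup (fun s : LTSeries (Fin (m + 1)) => (s.length : WithBot ℕ∞))
      ⟨m, id, fun i => Fin.castSucc_lt_succ⟩

/-- A space inducing into the spectrum of a polynomial ring, with points of transcendence degree at
least `c`, that contains a chain of subsets of transcendence degrees `c`, ..., `m + c` of which the
largest is dense, has dimension `m`. -/
theorem topologicalKrullDim_eq_of_chain {K : Type} [Field K] {d : ℕ}
    {φ : X → PrimeSpectrum (MvPolynomial (Fin d) K)} (hφ : IsInducing φ) {c m : ℕ}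
    (hc : ∀ x, c ≤ coordTrdeg (φ x).asIdeal) (T : Fin (m + 1) → Set X) (hT : Monotone T)
    (hprime : ∀ j, (vanishingIdeal (φ '' T j)).IsPrime)
    (htrd : ∀ j, coordTrdeg (vanishingIdeal (φ '' T j)) = j + c)
    (hdense : Dense (T (Fin.last m))) : topologicalKrullDim X = m := by
  have hprime' (Z : IrreducibleCloseds X) : (vanishingIdeal (φ '' (Z : Set X))).IsPrime :=
    isIrreducible_iff_vanishingIdeal_isPrime.1 (Z.isIrreducible.image φ hφ.continuous.continuousOn)
  have hmono {P Q : Ideal (MvPolynomial (Fin d) K)} (hP : P.IsPrime) (hQ : Q.IsPrime)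
      (h : P ≤ Q) : coordTrdeg Q ≤ coordTrdeg P := by
    rcases h.eq_or_lt with rfl | h
    · rfl
    · exact (coordTrdeg_lt h).le
  apply le_antisymm
  · have hle (Z : IrreducibleCloseds X) :
        coordTrdeg (vanishingIdeal (φ '' (Z : Set X))) ≤ m + c := by
      have := htrd (Fin.last m)
      rw [Fin.val_last] at this
      rw [← this]
      refine hmono (hprime _) (hprime' Z) ?_
      rw [← vanishingIdeal_image_closure hφ (T _), hdense.closure_eq]
      exact PrimeSpectrum.vanishingIdeal_anti_mono (Set.image_mono (Set.subset_univ _))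
    have hge (Z : IrreducibleCloseds X) :
        c ≤ coordTrdeg (vanishingIdeal (φ '' (Z : Set X))) := by
      obtain ⟨x, hx⟩ := Z.isIrreducible.nonempty
      refine (hc x).trans (hmono (hprime' Z) (φ x).2 ?_)
      intro a ha
      exact (mem_vanishingIdeal _ _).1 ha _ ⟨x, hx, rfl⟩
    -- The transcendence degree of the prime of `Z` lies between `c` and `m + c`, so subtracting `c`
    -- loses nothing and lands in `Fin (m + 1)`.
    rw [← krullDim_fin]
    refine Order.krullDim_le_of_strictMono
      (fun Z : IrreducibleCloseds X =>
        (⟨coordTrdeg (vanishingIdeal (φ '' (Z : Set X))) - c, by have := hle Z; omega⟩ :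
          Fin (m + 1))) ?_
    intro Z Z' h
    have := hprime' Z
    have := hprime' Z'
    have := coordTrdeg_lt (vanishingIdeal_image_lt hφ Z.isClosed (SetLike.coe_ssubset_coe.2 h))
    have := hge Z
    have := hge Z'
    simp only [Fin.mk_lt_mk]
    omega
  · rw [← krullDim_fin]
    refine Order.krullDim_le_of_strictMono (fun j => (⟨closure (T j), (isIrreducible_of_image hφ
      (isIrreducible_iff_vanishingIdeal_isPrime.2 (hprime j))).closure, isClosed_closure⟩ :
        IrreducibleCloseds X)) (Monotone.strictMono_of_injective ?_ ?_)
    · intro i j h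
      exact closure_mono (hT h)
    · intro i j h
      have h1 : closure (T i) = closure (T j) := congrArg (fun Z : IrreducibleCloseds X => (Z : Set X)) h
      have h2 := htrd i
      rw [← vanishingIdeal_image_closure hφ, h1, vanishingIdeal_image_closure hφ, htrd j] at h2
      exact Fin.ext (by omega)

end Inducing

section Dimension

open PrimeSpectrum

theorem dimension_closure_eq_of_chain {X K : Type} [Field K] {d : ℕ} (t : TopologicalSpace X)
    {φ : X → PrimeSpectrum (MvPolynomial (Fin d) K)} (hφ : Topology.IsInducing φ) {c m : ℕ}
    (hc : ∀ x, c ≤ coordTrdeg (φ x).asIdeal) (T : Fin (m + 1) → Set X) (hT : Monotone T)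
    (hprime : ∀ j, (vanishingIdeal (φ '' T j)).IsPrime)
    (htrd : ∀ j, coordTrdeg (vanishingIdeal (φ '' T j)) = j + c) :
    dimension t (closure (T (Fin.last m))) = m := by
  have himg (j) : (φ ∘ Subtype.val) '' ((↑) ⁻¹' T j : Set (closure (T (Fin.last m)))) = φ '' T j := by
    rw [Set.image_comp, Subtype.image_preimage_coe, Set.inter_eq_right.2]
    exact (hT (Fin.le_last j)).trans subset_closure
  refine topologicalKrullDim_eq_of_chain (X := closure (T (Fin.last m)))
    (φ := φ ∘ Subtype.val) (hφ.comp Topology.IsInducing.subtypeVal) (fun x => hc x)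
    (fun j => (↑) ⁻¹' T j) (fun i j h => Set.preimage_mono (hT h)) ?_ ?_ ?_
  · intro j
    rw [himg]
    exact hprime j
  · intro j
    rw [himg]
    exact htrd j
  · intro x
    rw [Topology.IsInducing.subtypeVal.closure_eq_preimage_closure_image, Set.mem_preimage,
      Subtype.image_preimage_coe, Set.inter_eq_right.2 subset_closure]
    exact x.2

end Dimension

/-! ### The Zariski topologies as induced topologies -/

section Zariski

variable {K : Type} [Field K] {d : ℕ}

/-- The maximal ideal of a point of affine space. -/
noncomputable def affinePoint (x : Fin d → K) : PrimeSpectrum (MvPolynomial (Fin d) K) :=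
  ⟨RingHom.ker (eval x), RingHom.ker_isPrime _⟩

theorem mem_affinePoint {x : Fin d → K} {g : MvPolynomial (Fin d) K} :
    g ∈ (affinePoint x).asIdeal ↔ eval x g = 0 := Iff.rfl

theorem isInducing_affinePoint :
    @Topology.IsInducing _ _ (affineZariski K d) _ (affinePoint (K := K) (d := d)) := by
  let := affineZariski K d
  refine ⟨TopologicalSpace.ext_isClosed fun Z => ?_⟩
  rw [isClosed_induced_iff]
  have h1 : IsClosed Z ↔ ∃ S : Set (MvPolynomial (Fin d) K), Z = affineZeros S := by
    rw [← isOpen_compl_iff]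
    change Zᶜᶜ ∈ _ ↔ _
    rw [compl_compl]
    rfl
  have h2 (S : Set (MvPolynomial (Fin d) K)) :
      affinePoint ⁻¹' PrimeSpectrum.zeroLocus S = affineZeros S := rfl
  rw [h1]
  constructor
  · rintro ⟨S, rfl⟩
    exact ⟨_, PrimeSpectrum.isClosed_zeroLocus S, h2 S⟩
  · rintro ⟨_, hC, rfl⟩
    obtain ⟨S, rfl⟩ := (PrimeSpectrum.isClosed_iff_zeroLocus _).1 hC
    exact ⟨S, h2 S⟩

theorem vanishingIdeal_affinePoint (S : Set (Fin d → K)) :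
    PrimeSpectrum.vanishingIdeal (affinePoint '' S) = MvPolynomial.vanishingIdeal K S := by
  ext g
  simp [PrimeSpectrum.mem_vanishingIdeal, mem_affinePoint, mem_vanishingIdeal_iff, aeval_eq_eval]

/-- The restriction of a polynomial to the line through a vector. -/
noncomputable def restrictLine (x : Fin d → K) : MvPolynomial (Fin d) K →ₐ[K] Polynomial K :=
  aeval fun i => Polynomial.C (x i) * Polynomial.X

theorem eval_restrictLine (x : Fin d → K) (g : MvPolynomial (Fin d) K) (c : K) :
    (restrictLine x g).eval c = eval (c • x) g := by
  rw [restrictLine, ← Polynomial.coe_aeval_eq_eval, ← AlgHom.comp_apply,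
    MvPolynomial.comp_aeval, ← aeval_eq_eval]
  congr 2
  refine funext fun i => ?_
  rw [map_mul, Polynomial.aeval_C, Polynomial.aeval_X]
  exact mul_comm _ _

/-- Consequently a polynomial vanishes on the line through `x`, as a polynomial in the parameter,
exactly when all its homogeneous components vanish at `x`. This matches homogeneous equations with
primes of lines, even over a finite field. -/
theorem coeff_restrictLine (x : Fin d → K) (g : MvPolynomial (Fin d) K) (n : ℕ) :
    (restrictLine x g).coeff n = eval x (homogeneousComponent n g) := by
  induction g using MvPolynomial.induction_on' with
  | add p q hp hq => simp [hp, hq]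
  | monomial s c =>
    have h1 : restrictLine x (monomial s c) =
        Polynomial.C (c * ∏ i, x i ^ s i) * Polynomial.X ^ s.degree := by
      rw [restrictLine, aeval_monomial, Finsupp.prod_fintype _ _ (fun i => pow_zero _),
        Finsupp.degree_eq_sum]
      simp only [mul_pow, Finset.prod_mul_distrib, Finset.prod_pow_eq_pow_sum, map_mul, map_prod,
        map_pow, mul_assoc]
      rfl
    rw [h1, Polynomial.coeff_C_mul_X_pow,
      homogeneousComponent_of_mem (isHomogeneous_monomial c rfl)]
    split_ifs
    · rw [eval_monomial, Finsupp.prod_fintype _ _ (fun i => pow_zero _)]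
    · simp

/-- The prime ideal of polynomials that vanish on the line of a point of projective space. -/
noncomputable def projPoint (p : ℙ K (Fin d → K)) : PrimeSpectrum (MvPolynomial (Fin d) K) :=
  ⟨RingHom.ker (restrictLine p.rep), RingHom.ker_isPrime _⟩

theorem mem_projPoint {p : ℙ K (Fin d → K)} {g : MvPolynomial (Fin d) K} :
    g ∈ (projPoint p).asIdeal ↔ ∀ n, eval p.rep (homogeneousComponent n g) = 0 := by
  simp_rw [← coeff_restrictLine, projPoint, RingHom.mem_ker, Polynomial.ext_iff]
  rfl

theorem isInducing_projPoint :
    @Topology.IsInducing _ _ (projZariski K d) _ (projPoint (K := K) (d := d)) := by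
  let := projZariski K d
  refine ⟨TopologicalSpace.ext_isClosed fun Z => ?_⟩
  rw [isClosed_induced_iff]
  have h1 : IsClosed Z ↔ ∃ S : Set (MvPolynomial (Fin d) K),
      (∀ g ∈ S, ∃ n, g.IsHomogeneous n) ∧ Z = projZeros S := by
    rw [← isOpen_compl_iff]
    change Zᶜᶜ ∈ _ ↔ _
    rw [compl_compl]
    rfl
  rw [h1]
  constructor
  · rintro ⟨S, hS, rfl⟩
    refine ⟨_, PrimeSpectrum.isClosed_zeroLocus S, ?_⟩
    ext p
    refine forall₂_congr fun g hg => ?_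
    obtain ⟨n, hn⟩ := hS g hg
    rw [SetLike.mem_coe, mem_projPoint]
    constructor
    · intro h
      have := h n
      rwa [homogeneousComponent_of_mem hn, if_pos rfl] at this
    · intro h m
      rw [homogeneousComponent_of_mem hn]
      split_ifs
      · exact h
      · exact map_zero _
  · rintro ⟨_, hC, rfl⟩
    obtain ⟨S, rfl⟩ := (PrimeSpectrum.isClosed_iff_zeroLocus _).1 hC
    refine ⟨{h | ∃ g ∈ S, ∃ n, h = homogeneousComponent n g}, ?_, ?_⟩
    · rintro _ ⟨g, -, n, rfl⟩
      exact ⟨n, homogeneousComponent_isHomogeneous n g⟩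
    · ext p
      constructor
      · rintro hp _ ⟨g, hg, n, rfl⟩
        exact mem_projPoint.1 (hp hg) n
      · intro hp g hg
        exact mem_projPoint.2 fun n => hp _ ⟨g, hg, n, rfl⟩

/-- The prime of a line is strictly contained in the maximal ideal of the origin. -/
theorem one_le_coordTrdeg_projPoint (p : ℙ K (Fin d → K)) :
    1 ≤ coordTrdeg (projPoint p).asIdeal := by
  have hlt : (projPoint p).asIdeal < (affinePoint (0 : Fin d → K)).asIdeal := by
    refine lt_of_le_not_ge (fun g hg => ?_) fun h => p.rep_nonzero (funext fun i => ?_)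
    · have := mem_projPoint.1 hg 0
      rw [homogeneousComponent_zero, eval_C] at this
      rw [mem_affinePoint, eval_zero, constantCoeff_eq, this]
    · have := mem_projPoint.1 (h (x := X i) (by simp [mem_affinePoint])) 1
      rwa [homogeneousComponent_of_mem (isHomogeneous_X _ _), if_pos rfl, eval_X] at this
  exact (Nat.zero_le _).trans_lt (coordTrdeg_lt hlt)

end Zariski

/-! ### Restriction of homogeneous polynomials to lines -/

section Line

variable {R : Type} [CommRing R] {d : ℕ}

/-- The univariate polynomial `t ↦ g (z + t b)`. -/
noncomputable def linePoly (g : MvPolynomial (Fin d) R) (b z : Fin d → R) : Polynomial R :=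
  aeval (fun i => Polynomial.C (z i) + Polynomial.C (b i) * Polynomial.X) g

theorem eval_linePoly (g : MvPolynomial (Fin d) R) (b z : Fin d → R) (t : R) :
    (linePoly g b z).eval t = eval (z + t • b) g := by
  rw [linePoly, ← Polynomial.coe_aeval_eq_eval, ← AlgHom.comp_apply, MvPolynomial.comp_aeval,
    ← aeval_eq_eval]
  congr 2
  refine funext fun i => ?_
  rw [map_add, map_mul, Polynomial.aeval_C, Polynomial.aeval_C, Polynomial.aeval_X]
  exact congrArg (z i + ·) (mul_comm _ _)

theorem map_linePoly {S : Type} [CommRing S] (φ : R →+* S) (g : MvPolynomial (Fin d) R)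
    (b z : Fin d → R) :
    (linePoly g b z).map φ = linePoly (map φ g) (φ ∘ b) (φ ∘ z) := by
  induction g using MvPolynomial.induction_on with
  | C a => simp [linePoly]
  | add p q hp hq => simp only [linePoly, map_add, Polynomial.map_add] at *; rw [hp, hq]
  | mul_X p i hp =>
    simp only [linePoly, map_mul, Polynomial.map_mul] at *
    rw [hp]
    simp

theorem linePoly_degree_coeff {g : MvPolynomial (Fin d) R} {n : ℕ} (hg : g.IsHomogeneous n)
    (b z : Fin d → R) :
    (linePoly g b z).natDegree ≤ n ∧ (linePoly g b z).coeff n = eval b g := by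
  have hlin (i : Fin d) (m : ℕ) :
      ((Polynomial.C (z i) + Polynomial.C (b i) * Polynomial.X) ^ m).natDegree ≤ m ∧
      ((Polynomial.C (z i) + Polynomial.C (b i) * Polynomial.X) ^ m).coeff m = b i ^ m := by
    have h1 : (Polynomial.C (z i) + Polynomial.C (b i) * Polynomial.X).natDegree ≤ 1 := by
      compute_degree
    refine ⟨(Polynomial.natDegree_pow_le_of_le m h1).trans (mul_one m).le, ?_⟩
    have := Polynomial.coeff_pow_of_natDegree_le (m := m) h1
    rw [mul_one] at this
    rw [this]
    simp
  have hmon (s : Fin d →₀ ℕ) (u : Finset (Fin d)) :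
      (∏ i ∈ u, (Polynomial.C (z i) + Polynomial.C (b i) * Polynomial.X) ^ s i).natDegree
        ≤ ∑ i ∈ u, s i ∧
      (∏ i ∈ u, (Polynomial.C (z i) + Polynomial.C (b i) * Polynomial.X) ^ s i).coeff
        (∑ i ∈ u, s i) = ∏ i ∈ u, b i ^ s i := by
    induction u using Finset.induction_on with
    | empty => simp
    | insert i u hi ih =>
      rw [Finset.prod_insert hi, Finset.sum_insert hi, Finset.prod_insert hi]
      refine ⟨Polynomial.natDegree_mul_le_of_le (hlin i _).1 ih.1, ?_⟩
      rw [Polynomial.coeff_mul_add_eq_of_natDegree_le (hlin i _).1 ih.1, (hlin i _).2, ih.2]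
  have hsum : linePoly g b z = ∑ s ∈ g.support, Polynomial.C (coeff s g) *
      ∏ i, (Polynomial.C (z i) + Polynomial.C (b i) * Polynomial.X) ^ s i := by
    rw [linePoly, aeval_def, eval₂_eq']
    rfl
  have hdeg {s : Fin d →₀ ℕ} (hs : s ∈ g.support) : ∑ i, s i = n := by
    rw [← Finsupp.degree_eq_sum]
    by_contra h
    exact mem_support_iff.1 hs (hg.coeff_eq_zero h)
  constructor
  · rw [hsum]
    refine Polynomial.natDegree_sum_le_of_forall_le _ _ fun s hs => ?_
    refine (Polynomial.natDegree_C_mul_le _ _).trans ?_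
    rw [← hdeg hs]
    exact (hmon s _).1
  · rw [hsum, Polynomial.finsetSum_coeff, eval_eq']
    refine Finset.sum_congr rfl fun s hs => ?_
    rw [Polynomial.coeff_C_mul, ← hdeg hs, (hmon s _).2]

theorem eval_smul_of_isHomogeneous {g : MvPolynomial (Fin d) R} {n : ℕ} (hg : g.IsHomogeneous n)
    (c : R) (x : Fin d → R) : eval (c • x) g = c ^ n * eval x g := by
  rw [eval_eq', eval_eq', Finset.mul_sum]
  refine Finset.sum_congr rfl fun s hs => ?_
  have hdeg : ∑ i, s i = n := by
    rw [← Finsupp.degree_eq_sum]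
    by_contra h
    exact mem_support_iff.1 hs (hg.coeff_eq_zero h)
  simp only [Pi.smul_apply, smul_eq_mul, mul_pow, Finset.prod_mul_distrib,
    Finset.prod_pow_eq_pow_sum, hdeg]
  ring

end Line

/-! ### Hyperbolicity with respect to all points of the cone -/

section Garding

open Complex

variable {d p : ℕ}

/-- A lower bound for a complex homogeneous polynomial on a line whose zeros on that line all lie
in the closed lower half plane. -/
theorem le_norm_eval_of_forall_ne_zero {g : MvPolynomial (Fin d) ℂ} (hg : g.IsHomogeneous p)
    (b z : Fin d → ℂ) (h : ∀ t : ℂ, 0 < t.im → eval (z + t • b) g ≠ 0) (t : ℂ) (ht : 0 < t.im) :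
    ‖eval b g‖ * t.im ^ p ≤ ‖eval (z + t • b) g‖ := by
  by_cases hb : eval b g = 0
  · simp [hb]
  obtain ⟨hdeg, hcoeff⟩ := linePoly_degree_coeff hg b z
  have hnat : (linePoly g b z).natDegree = p :=
    Polynomial.natDegree_eq_of_le_of_coeff_ne_zero hdeg (hcoeff ▸ hb)
  have hsplit := IsAlgClosed.splits (linePoly g b z)
  rw [← eval_linePoly, hsplit.eval_eq_prod_roots, Polynomial.leadingCoeff, hnat, hcoeff, norm_mul]
  refine mul_le_mul_of_nonneg_left ?_ (norm_nonneg _)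
  have hcard : (linePoly g b z).roots.card = p := by
    rw [← hnat, hsplit.natDegree_eq_card_roots]
  have key (s : Multiset ℂ) (hs : ∀ r ∈ s, t.im ≤ ‖t - r‖) :
      t.im ^ s.card ≤ ‖(s.map (t - ·)).prod‖ := by
    induction s using Multiset.induction_on with
    | empty => simp
    | cons r s ih =>
      rw [Multiset.card_cons, Multiset.map_cons, Multiset.prod_cons, norm_mul, pow_succ']
      exact mul_le_mul (hs r (Multiset.mem_cons_self r s))
        (ih fun x hx => hs x (Multiset.mem_cons_of_mem hx)) (pow_nonneg ht.le _) (norm_nonneg _)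
  have := key (linePoly g b z).roots fun r hr => ?_
  · rwa [hcard] at this
  have hr0 : eval (z + r • b) g = 0 := by
    rw [← eval_linePoly]
    exact Polynomial.isRoot_of_mem_roots hr
  have hrim : r.im ≤ 0 := not_lt.1 fun hpos => h r hpos hr0
  calc t.im ≤ (t - r).im := by rw [sub_im]; linarith
    _ ≤ ‖t - r‖ := (le_abs_self _).trans (abs_im_le_norm _)

/-- The zeros of a homogeneous polynomial on a line are bounded linearly in the base point. -/
theorem exists_norm_le_of_eval_eq_zero {g : MvPolynomial (Fin d) ℂ} (hg : g.IsHomogeneous p)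
    (b : Fin d → ℂ) (hb : eval b g ≠ 0) :
    ∃ M : ℝ, ∀ (z : Fin d → ℂ) (t : ℂ), eval (z + t • b) g = 0 → ‖t‖ ≤ M * ‖z‖ := by
  have hopen : IsOpen {w : Fin d → ℂ | eval w g ≠ 0} :=
    isOpen_ne_fun (MvPolynomial.continuous_eval g) continuous_const
  -- For a zero with `t ≠ 0`, homogeneity makes `t⁻¹ • z + b` a zero as well. It lies outside this
  -- ball, so `‖t⁻¹ • z‖ ≥ ε`.
  obtain ⟨ε, hε, hball⟩ := Metric.isOpen_iff.1 hopen b hb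
  refine ⟨ε⁻¹, fun z t h => ?_⟩
  by_contra! hlt
  have ht : t ≠ 0 := by
    rintro rfl
    rw [norm_zero] at hlt
    exact absurd hlt (not_lt.2 (by positivity))
  have h1 : z + t • b = t • (t⁻¹ • z + b) := by
    rw [smul_add, smul_smul, mul_inv_cancel₀ ht, one_smul]
  rw [h1, eval_smul_of_isHomogeneous hg] at h
  refine hball ?_ ((mul_eq_zero.1 h).resolve_left (pow_ne_zero _ ht))
  rw [mem_ball_iff_norm, add_sub_cancel_right, norm_smul, norm_inv]
  have htpos : 0 < ‖t‖ := norm_pos_iff.2 ht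
  rw [inv_mul_lt_iff₀ hε] at hlt
  rwa [inv_mul_lt_iff₀ htpos, mul_comm]

/-- The complexification of a real vector. -/
def cvec (v : Fin d → ℝ) : Fin d → ℂ := fun i => (v i : ℂ)

theorem continuous_cvec : Continuous (cvec (d := d)) :=
  continuous_pi fun i => continuous_ofReal.comp (continuous_apply i)

theorem cvec_add (v w : Fin d → ℝ) : cvec (v + w) = cvec v + cvec w := by
  ext i; simp [cvec]

theorem cvec_smul (c : ℝ) (v : Fin d → ℝ) : cvec (c • v) = (c : ℂ) • cvec v := by
  ext i; simp [cvec]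

/-- The complexification of a real polynomial. -/
noncomputable def cpoly (f : MvPolynomial (Fin d) ℝ) : MvPolynomial (Fin d) ℂ :=
  map ofRealHom f

theorem eval_cvec (f : MvPolynomial (Fin d) ℝ) (v : Fin d → ℝ) :
    eval (cvec v) (cpoly f) = (eval v f : ℂ) :=
  (MvPolynomial.eval_map ..).trans (MvPolynomial.eval₂_comp _ _ _).symm

/-- `f` has no zero in the tube over `a`. -/
def NonvanishingOnTube (f : MvPolynomial (Fin d) ℝ) (a : Fin d → ℝ) : Prop :=
  ∀ v : Fin d → ℝ, eval (cvec v + I • cvec a) (cpoly f) ≠ 0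

variable {f : MvPolynomial (Fin d) ℝ}

theorem cpoly_isHomogeneous (hf : f.IsHomogeneous p) : (cpoly f).IsHomogeneous p := hf.map _

/-- Dividing by the real number `t.im` and absorbing `t.re` into the real part reduces every
non-real `t` to `I`. -/
theorem NonvanishingOnTube.eval_ne_zero (hf : f.IsHomogeneous p) {a : Fin d → ℝ}
    (h : NonvanishingOnTube f a) (v : Fin d → ℝ) (t : ℂ) (ht : t.im ≠ 0) :
    eval (cvec v + t • cvec a) (cpoly f) ≠ 0 := by
  have h1 : cvec v + t • cvec a = (t.im : ℂ) • (cvec (t.im⁻¹ • (v + t.re • a)) + I • cvec a) := by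
    have : (t.im : ℂ) ≠ 0 := ofReal_ne_zero.2 ht
    rw [smul_add, cvec_smul, smul_smul, ofReal_inv, mul_inv_cancel₀ this, one_smul, cvec_add,
      cvec_smul, add_assoc, smul_smul, ← add_smul, re_add_im t]
  rw [h1, eval_smul_of_isHomogeneous (cpoly_isHomogeneous hf)]
  exact mul_ne_zero (pow_ne_zero _ (ofReal_ne_zero.2 ht)) (h _)

theorem IsHyperbolic.nonvanishingOnTube {τ : Fin d → ℝ} (hf : IsHyperbolic f p τ) :
    NonvanishingOnTube f τ := by
  intro v h0
  obtain ⟨hdeg, hcoeff⟩ := linePoly_degree_coeff hf.homogeneous τ v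
  have hne : (linePoly f τ v).coeff p ≠ 0 := hcoeff ▸ hf.ne_zero
  have hnat : (linePoly f τ v).natDegree = p :=
    Polynomial.natDegree_eq_of_le_of_coeff_ne_zero hdeg hne
  have hsplit : (linePoly f τ v).Splits :=
    Polynomial.splits_iff_card_roots.2 ((hf.real_rooted v).trans hnat.symm)
  have hroot : ((linePoly f τ v).map ofRealHom).IsRoot I := by
    rw [map_linePoly, Polynomial.IsRoot, eval_linePoly]
    exact h0
  obtain ⟨x, hx⟩ := hsplit.mem_range_of_isRoot (fun h => hne (by rw [h, Polynomial.coeff_zero])) hroot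
  have := congrArg im hx
  simp at this

/-- Gårding: hyperbolicity propagates along rays on which `f` does not vanish. -/
theorem NonvanishingOnTube.norm_le (hf : f.IsHomogeneous p) {a b : Fin d → ℝ}
    (ha : NonvanishingOnTube f a) (hab : ∀ x : ℝ, 0 ≤ x → eval (b + x • a) f ≠ 0)
    (v : Fin d → ℝ) : ‖eval b f‖ ≤ ‖eval (cvec v + I • cvec b) (cpoly f)‖ := by
  have hF := cpoly_isHomogeneous hf
  have hb : eval b f ≠ 0 := by simpa using hab 0 le_rfl
  have hbC : eval (cvec b) (cpoly f) ≠ 0 := by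
    rw [eval_cvec]
    exact ofReal_ne_zero.2 hb
  -- A homotopy in `s` from `0` to `v`, with the shift `α I a` keeping zeros in `t` off the real
  -- axis. The claim is that no zero ever enters the upper half plane; at the end `α` tends to 0.
  let base (α s : ℝ) : Fin d → ℂ := (s : ℂ) • cvec v + ((α : ℂ) * I) • cvec a
  have hcont (α : ℝ) : Continuous fun s => base α s := by fun_prop
  have hreal (α : ℝ) (hα : 0 < α) (s t : ℝ) :
      eval (base α s + (t : ℂ) • cvec b) (cpoly f) ≠ 0 := by
    have := ha.eval_ne_zero hf (s • v + t • b) (α * I) (by simp [hα.ne'])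
    rwa [cvec_add, cvec_smul, cvec_smul, add_right_comm] at this
  -- At `s = 0`, divide by `t`: the coefficient `α I / t` of `a` is either non-real, where the tube
  -- condition for `a` applies, or a positive real, where `hab` applies.
  have hzero (α : ℝ) (hα : 0 < α) (t : ℂ) (ht : 0 < t.im) :
      eval (base α 0 + t • cvec b) (cpoly f) ≠ 0 := by
    have ht0 : t ≠ 0 := by rintro rfl; simp at ht
    have h1 : base α 0 + t • cvec b = t • (cvec b + (α * I / t) • cvec a) := by
      simp only [base, ofReal_zero, zero_smul, zero_add]
      rw [smul_add, smul_smul, mul_div_cancel₀ _ ht0, add_comm]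
    rw [h1, eval_smul_of_isHomogeneous hF]
    refine mul_ne_zero (pow_ne_zero _ ht0) ?_
    by_cases him : (α * I / t).im = 0
    · obtain ⟨x, hx⟩ : ∃ x : ℝ, (x : ℂ) = α * I / t := ⟨_, Complex.ext rfl him.symm⟩
      have hx' : x * t = α * I := by rw [hx, div_mul_cancel₀ _ ht0]
      have hxim : x * t.im = α := by simpa using congrArg im hx'
      have hxpos : 0 < x := not_le.1 fun h => by
        have := mul_nonpos_of_nonpos_of_nonneg h ht.le
        linarith
      rw [← hx, ← cvec_smul, ← cvec_add, eval_cvec]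
      exact ofReal_ne_zero.2 (hab x hxpos.le)
    · exact ha.eval_ne_zero hf b _ him
  have hall (α : ℝ) (hα : 0 < α) (s : ℝ) (t : ℂ) (ht : 0 < t.im) :
      eval (base α s + t • cvec b) (cpoly f) ≠ 0 := by
    let T : Set ℝ := {s | ∀ t : ℂ, 0 < t.im → eval (base α s + t • cvec b) (cpoly f) ≠ 0}
    -- Nonvanishing on the half plane is equivalent to a uniform lower bound, and this bound passes
    -- to limits in `s`.
    have hclosed : IsClosed T := by
      have : T = {s | ∀ t : ℂ, 0 < t.im →
          ‖eval (cvec b) (cpoly f)‖ * t.im ^ p ≤ ‖eval (base α s + t • cvec b) (cpoly f)‖} := by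
        ext s
        constructor
        · intro hs t ht
          exact le_norm_eval_of_forall_ne_zero hF _ _ hs t ht
        · intro hs t ht h0
          have := hs t ht
          rw [h0, norm_zero] at this
          exact absurd this (not_le.2 (by positivity))
      rw [this]
      simp only [Set.ofPred_forall]
      refine isClosed_iInter fun t => isClosed_iInter fun _ => isClosed_le continuous_const ?_
      exact ((MvPolynomial.continuous_eval _).comp ((hcont α).add continuous_const)).norm
    -- Zeros for a convergent sequence of bad `s` are bounded, so a subsequence converges to a zero
    -- with `0 ≤ t₀.im`. It is not real by `hreal`, so the limit `s₀` is bad too.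
    have hopen : IsOpen T := by
      obtain ⟨M, hM⟩ := exists_norm_le_of_eval_eq_zero hF _ hbC
      rw [← isClosed_compl_iff]
      refine IsSeqClosed.isClosed fun s s₀ hs hlim => ?_
      have hs' (n : ℕ) : ∃ t : ℂ, 0 < t.im ∧ eval (base α (s n) + t • cvec b) (cpoly f) = 0 := by
        have := hs n
        simp only [T, Set.mem_compl_iff, Set.mem_ofPred_eq, not_forall, not_not] at this
        obtain ⟨t, ht, h0⟩ := this
        exact ⟨t, ht, h0⟩
      choose t ht h0 using hs'
      have hbdd : Bornology.IsBounded (Set.range t) := by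
        have h1 := ((hcont α).tendsto s₀).comp hlim
        obtain ⟨B, hB⟩ := (Metric.isBounded_range_of_tendsto _ h1).exists_norm_le
        refine isBounded_iff_forall_norm_le.2 ⟨|M| * B, ?_⟩
        rintro _ ⟨n, rfl⟩
        calc ‖t n‖ ≤ M * ‖base α (s n)‖ := hM _ _ (h0 n)
          _ ≤ |M| * B := mul_le_mul (le_abs_self M) (hB _ ⟨n, rfl⟩) (norm_nonneg _) (abs_nonneg M)
      obtain ⟨t₀, -, φ, hφ, hlimt⟩ := tendsto_subseq_of_bounded hbdd fun n => ⟨n, rfl⟩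
      have h0' : eval (base α s₀ + t₀ • cvec b) (cpoly f) = 0 := by
        have h1 := ((hcont α).tendsto s₀).comp (hlim.comp hφ.tendsto_atTop)
        have h2 := ((MvPolynomial.continuous_eval (cpoly f)).tendsto _).comp
          (h1.add (hlimt.smul_const (cvec b)))
        refine tendsto_nhds_unique h2 ?_
        refine tendsto_const_nhds.congr fun n => (h0 (φ n)).symm
      have him : 0 ≤ t₀.im :=
        ge_of_tendsto' ((continuous_im.tendsto _).comp hlimt) fun n => (ht (φ n)).le
      intro hT
      rcases him.eq_or_lt with h | h
      · refine hreal α hα s₀ t₀.re ?_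
        rwa [show (t₀.re : ℂ) = t₀ from Complex.ext rfl h]
      · exact hT t₀ h h0'
    have huniv : T = Set.univ :=
      IsClopen.eq_univ ⟨hclosed, hopen⟩ ⟨0, fun t ht => hzero α hα t ht⟩
    exact (huniv ▸ Set.mem_univ s : s ∈ T) t ht
  have hle (α : ℝ) (hα : 0 < α) :
      ‖eval b f‖ ≤ ‖eval (base α 1 + I • cvec b) (cpoly f)‖ := by
    have := le_norm_eval_of_forall_ne_zero hF (cvec b) (base α 1) (hall α hα 1) I (by simp)
    rwa [eval_cvec, norm_real, I_im, one_pow, mul_one] at this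
  have hcontα : Continuous fun α : ℝ => ‖eval (base α 1 + I • cvec b) (cpoly f)‖ :=
    ((MvPolynomial.continuous_eval _).comp (by fun_prop)).norm
  have hlim := (hcontα.tendsto 0).mono_left (nhdsWithin_le_nhds (s := Set.Ioi 0))
  have := ge_of_tendsto hlim (Filter.eventually_of_mem self_mem_nhdsWithin hle)
  simpa [base] using this

/-- Gårding: `f` is hyperbolic with respect to every point of its hyperbolicity cone. -/
theorem IsHyperbolic.nonvanishingOnTube_of_mem {τ : Fin d → ℝ} (hf : IsHyperbolic f p τ)
    {a : Fin d → ℝ} (ha : a ∈ hyperbolicityCone f τ) : NonvanishingOnTube f a := by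
  have hhom := hf.homogeneous
  have hopen : IsOpen {θ : Fin d → ℝ | eval θ f ≠ 0} :=
    isOpen_ne_fun (MvPolynomial.continuous_eval f) continuous_const
  let u : Set (Fin d → ℝ) := {a | eval a f ≠ 0 ∧ NonvanishingOnTube f a}
  have hstep {a b : Fin d → ℝ} (ha : NonvanishingOnTube f a)
      (hab : ∀ x : ℝ, 0 ≤ x → eval (b + x • a) f ≠ 0) : NonvanishingOnTube f b := by
    intro v h0
    have := ha.norm_le hhom hab v
    rw [h0, norm_zero, norm_le_zero_iff] at this
    exact hab 0 le_rfl (by simpa using this)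
  -- Up to the factor `1 + x`, the point `b + x • a` is a convex combination of `b` and `a`, hence
  -- in the ball.
  have hsum {a b : Fin d → ℝ} {ε : ℝ} (hball : Metric.ball a ε ⊆ {θ : Fin d → ℝ | eval θ f ≠ 0})
      (hb : b ∈ Metric.ball a ε) (x : ℝ) (hx : 0 ≤ x) : eval (b + x • a) f ≠ 0 := by
    have h1 : (1 + x) ≠ 0 := by positivity
    have h2 : b + x • a = (1 + x) • ((1 + x)⁻¹ • b + ((1 + x)⁻¹ * x) • a) := by
      rw [smul_add, smul_smul, smul_smul, mul_inv_cancel₀ h1, one_smul, ← mul_assoc,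
        mul_inv_cancel₀ h1, one_mul]
    rw [h2, eval_smul_of_isHomogeneous hhom]
    refine mul_ne_zero (pow_ne_zero _ h1) (hball ?_)
    refine (convex_ball a ε) hb (Metric.mem_ball_self (dist_nonneg.trans_lt hb)) (by positivity)
      (by positivity) ?_
    field_simp
  have hu : IsOpen u := by
    rw [Metric.isOpen_iff]
    rintro a ⟨ha0, ha⟩
    obtain ⟨ε, hε, hball⟩ := Metric.isOpen_iff.1 hopen a ha0
    exact ⟨ε, hε, fun b hb => ⟨hball hb, hstep ha (hsum hball hb)⟩⟩
  -- The quantitative bound survives passage to the closure of `u`, and where `f ≠ 0` it gives back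
  -- nonvanishing. So `u` is open and relatively closed in `{f ≠ 0}`.
  have hclosed : IsClosed {a : Fin d → ℝ | ∀ v : Fin d → ℝ,
      ‖eval a f‖ ≤ ‖eval (cvec v + I • cvec a) (cpoly f)‖} := by
    rw [Set.ofPred_forall]
    refine isClosed_iInter fun v => isClosed_le (MvPolynomial.continuous_eval f).norm ?_
    exact ((MvPolynomial.continuous_eval _).comp
      (continuous_const.add (continuous_cvec.const_smul I))).norm
  have hsub : closure u ⊆ {a : Fin d → ℝ | ∀ v : Fin d → ℝ,
      ‖eval a f‖ ≤ ‖eval (cvec v + I • cvec a) (cpoly f)‖} := by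
    refine closure_minimal ?_ hclosed
    rintro a ⟨ha0, ha⟩
    obtain ⟨ε, hε, hball⟩ := Metric.isOpen_iff.1 hopen a ha0
    exact ha.norm_le hhom (hsum hball (Metric.mem_ball_self hε))
  have hC : hyperbolicityCone f τ ⊆ u := by
    refine isPreconnected_connectedComponentIn.subset_of_closure_inter_subset hu
      ⟨τ, mem_connectedComponentIn hf.ne_zero, hf.ne_zero, hf.nonvanishingOnTube⟩ ?_
    rintro b ⟨hb, hbC⟩
    have hb0 : eval b f ≠ 0 := connectedComponentIn_subset _ _ hbC
    refine ⟨hb0, fun v h0 => hb0 ?_⟩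
    have := hsub hb v
    rwa [h0, norm_zero, norm_le_zero_iff] at this
  exact (hC ha).2

end Garding

/-! ### Positivity of the second logarithmic derivative -/

section Positivity

variable {d p : ℕ} {f : MvPolynomial (Fin d) ℝ} {τ : Fin d → ℝ}

/-- The `r` are the roots of `t ↦ f (w + t a)`, all real by Gårding. Homogeneity, `f (a + t w) = t ^
p * f (w + t⁻¹ a)`, reverses the polynomial. -/
theorem IsHyperbolic.exists_linePoly_eq (hf : IsHyperbolic f p τ) {a : Fin d → ℝ}
    (ha : a ∈ hyperbolicityCone f τ) (w : Fin d → ℝ) :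
    ∃ s : Multiset ℝ, linePoly f w a =
      Polynomial.C (eval a f) * (s.map fun r => 1 - Polynomial.C r * Polynomial.X).prod := by
  have htube := hf.nonvanishingOnTube_of_mem ha
  have ha0 : eval a f ≠ 0 := connectedComponentIn_subset _ _ ha
  obtain ⟨hdeg, hcoeff⟩ := linePoly_degree_coeff hf.homogeneous a w
  have hnat : (linePoly f a w).natDegree = p :=
    Polynomial.natDegree_eq_of_le_of_coeff_ne_zero hdeg (hcoeff ▸ ha0)
  have hsplit : (linePoly f a w).Splits := by
    refine .of_splits_map Complex.ofRealHom (IsAlgClosed.splits _) fun t ht => ?_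
    have h0 := Polynomial.isRoot_of_mem_roots ht
    rw [map_linePoly, Polynomial.IsRoot, eval_linePoly] at h0
    have him : t.im = 0 := by
      by_contra him
      exact htube.eval_ne_zero hf.homogeneous w t him h0
    exact ⟨t.re, Complex.ext rfl him.symm⟩
  have hcard : (linePoly f a w).roots.card = p := by
    rw [← hsplit.natDegree_eq_card_roots, hnat]
  refine ⟨(linePoly f a w).roots, Polynomial.funext fun t => ?_⟩
  rw [eval_linePoly, Polynomial.eval_mul, Polynomial.eval_C]
  by_cases ht : t = 0
  · subst ht
    simp [Polynomial.eval_multiset_prod]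
  have h1 : a + t • w = t • (w + t⁻¹ • a) := by
    rw [smul_add, smul_smul, mul_inv_cancel₀ ht, one_smul, add_comm]
  rw [h1, eval_smul_of_isHomogeneous hf.homogeneous, ← eval_linePoly, hsplit.eval_eq_prod_roots,
    Polynomial.leadingCoeff, hnat, hcoeff, ← hcard, Polynomial.eval_multiset_prod, Multiset.map_map]
  have key (s : Multiset ℝ) : t ^ s.card * (s.map (t⁻¹ - ·)).prod =
      (s.map fun r => (1 - Polynomial.C r * Polynomial.X).eval t).prod := by
    induction s using Multiset.induction_on with
    | empty => simp
    | cons r s ih =>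
      rw [Multiset.card_cons, Multiset.map_cons, Multiset.prod_cons, Multiset.map_cons,
        Multiset.prod_cons, ← ih]
      simp only [Polynomial.eval_sub, Polynomial.eval_one, Polynomial.eval_mul, Polynomial.eval_C,
        Polynomial.eval_X]
      have : (1 - r * t) = t * (t⁻¹ - r) := by field_simp
      rw [this]
      ring
  rw [mul_left_comm, key]
  rfl

theorem smul_mem_hyperbolicityCone (hf : f.IsHomogeneous p) {a : Fin d → ℝ}
    (ha : a ∈ hyperbolicityCone f τ) {c : ℝ} (hc : 0 < c) : c • a ∈ hyperbolicityCone f τ := by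
  have ha0 : eval a f ≠ 0 := connectedComponentIn_subset _ _ ha
  have heq : hyperbolicityCone f τ = connectedComponentIn {θ | eval θ f ≠ 0} a :=
    connectedComponentIn_eq ha
  have hsub : (fun c : ℝ => c • a) '' Set.Ioi 0 ⊆ connectedComponentIn {θ | eval θ f ≠ 0} a := by
    refine IsPreconnected.subset_connectedComponentIn ?_ ⟨1, Set.mem_Ioi.2 zero_lt_one, one_smul _ _⟩ ?_
    · exact isPreconnected_Ioi.image _ (by fun_prop)
    · rintro _ ⟨c, hc, rfl⟩
      change eval (c • a) f ≠ 0
      rw [eval_smul_of_isHomogeneous hf]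
      exact mul_ne_zero (pow_ne_zero _ (Set.mem_Ioi.1 hc).ne') ha0
  rw [heq]
  exact hsub ⟨c, hc, rfl⟩

/-- The whole line lies in the cone. Rescaling its far ends puts both `w` and `-w` in the closed
cone, which is pointed. -/
theorem eq_zero_of_forall_eval_add_smul_ne_zero (hf : f.IsHomogeneous p) (hcomplete : IsComplete f τ)
    {a : Fin d → ℝ} (ha : a ∈ hyperbolicityCone f τ) {w : Fin d → ℝ}
    (h : ∀ t : ℝ, eval (a + t • w) f ≠ 0) : w = 0 := by
  have heq : hyperbolicityCone f τ = connectedComponentIn {θ | eval θ f ≠ 0} a :=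
    connectedComponentIn_eq ha
  have hline (t : ℝ) : a + t • w ∈ hyperbolicityCone f τ := by
    rw [heq]
    have hsub : Set.range (fun t : ℝ => a + t • w) ⊆ connectedComponentIn {θ | eval θ f ≠ 0} a := by
      refine IsPreconnected.subset_connectedComponentIn ?_ ⟨0, by simp⟩ ?_
      · exact isPreconnected_range (by fun_prop)
      · rintro _ ⟨t, rfl⟩
        exact h t
    exact hsub ⟨t, rfl⟩
  have hmem (ε : ℝ) (hε : ε ≠ 0) : ε • w ∈ closure (hyperbolicityCone f τ) := by
    have hlim : Filter.Tendsto (fun c : ℝ => c • a + ε • w) (nhdsWithin 0 (Set.Ioi 0))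
        (nhds (ε • w)) := by
      have : Continuous fun c : ℝ => c • a + ε • w := by fun_prop
      simpa using (this.tendsto 0).mono_left nhdsWithin_le_nhds
    refine mem_closure_of_tendsto hlim (Filter.eventually_of_mem self_mem_nhdsWithin fun c hc => ?_)
    have hc' : (0 : ℝ) < c := hc
    have : c • a + ε • w = c • (a + (c⁻¹ * ε) • w) := by
      rw [smul_add, smul_smul, mul_inv_cancel_left₀ hc'.ne']
    rw [this]
    exact smul_mem_hyperbolicityCone hf (hline _) hc'
  have h0 : w ∈ closure (hyperbolicityCone f τ) ∩ -closure (hyperbolicityCone f τ) :=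
    ⟨by simpa using hmem 1 one_ne_zero, by simpa using hmem (-1) (by norm_num)⟩
  rw [hcomplete] at h0
  exact h0

/-- For the product `Q` this yields `-(log Q)'' = Q' ^ 2 - Q'' = ∑ r ^ 2` at 0. -/
theorem eval_zero_prod_one_sub (s : Multiset ℝ) :
    (s.map fun r => 1 - Polynomial.C r * Polynomial.X).prod.eval 0 = 1 ∧
    (Polynomial.derivative (s.map fun r => 1 - Polynomial.C r * Polynomial.X).prod).eval 0 = -s.sum ∧
    (Polynomial.derivative (Polynomial.derivative (s.map fun r => 1 - Polynomial.C r * Polynomial.X).prod)).eval 0 =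
      s.sum ^ 2 - (s.map (· ^ 2)).sum := by
  induction s using Multiset.induction_on with
  | empty => simp
  | cons r s ih =>
    obtain ⟨h0, h1, h2⟩ := ih
    simp only [Multiset.map_cons, Multiset.prod_cons, Multiset.sum_cons, Polynomial.derivative_mul,
      Polynomial.derivative_sub, Polynomial.derivative_one, Polynomial.derivative_C,
      Polynomial.derivative_X, Polynomial.eval_mul, Polynomial.eval_sub, Polynomial.eval_add,
      Polynomial.eval_one, Polynomial.eval_C, Polynomial.eval_X, h0, h1, h2,
      Polynomial.derivative_add, Polynomial.derivative_zero, Polynomial.eval_zero]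
    refine ⟨by ring, by ring, by ring⟩

/-- The negative logarithm of `f` is strictly convex at every point of the hyperbolicity cone. -/
theorem IsHyperbolic.exists_hasDerivAt_pos (hf : IsHyperbolic f p τ) (hcomplete : IsComplete f τ)
    {a : Fin d → ℝ} (ha : a ∈ hyperbolicityCone f τ) {w : Fin d → ℝ} (hw : w ≠ 0) :
    ∃ c > 0, HasDerivAt
      (fun t => -((linePoly f w a).derivative.eval t / (linePoly f w a).eval t)) c 0 := by
  obtain ⟨s, hs⟩ := hf.exists_linePoly_eq ha w
  have ha0 : eval a f ≠ 0 := connectedComponentIn_subset _ _ ha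
  obtain ⟨h0, h1, h2⟩ := eval_zero_prod_one_sub s
  refine ⟨(s.map (· ^ 2)).sum, ?_, ?_⟩
  · have hnonneg : ∀ x ∈ s.map (· ^ 2), (0 : ℝ) ≤ x := by
      intro x hx
      obtain ⟨r, -, rfl⟩ := Multiset.mem_map.1 hx
      positivity
    refine (Multiset.sum_nonneg hnonneg).lt_of_ne fun hzero => hw ?_
    have hall : ∀ r ∈ s, r = 0 := by
      intro r hr
      have := Multiset.single_le_sum hnonneg (r ^ 2) (Multiset.mem_map_of_mem _ hr)
      rw [← hzero] at this
      exact pow_eq_zero_iff two_ne_zero |>.1 (le_antisymm this (sq_nonneg r))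
    refine eq_zero_of_forall_eval_add_smul_ne_zero hf.homogeneous hcomplete ha fun t => ?_
    rw [← eval_linePoly, hs, Multiset.map_congr rfl (g := fun _ => (1 : Polynomial ℝ)) fun r hr => by
      rw [hall r hr, Polynomial.C_0, zero_mul, sub_zero]]
    simpa using ha0
  · have hQ := (linePoly f w a).hasDerivAt 0
    have hQ' := (linePoly f w a).derivative.hasDerivAt 0
    have hne : (linePoly f w a).eval 0 ≠ 0 := by
      rw [eval_linePoly]
      simpa using ha0
    refine (hQ'.div hQ hne).neg.congr_deriv ?_
    rw [hs] at hne ⊢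
    simp only [Polynomial.derivative_C_mul, Polynomial.eval_mul, Polynomial.eval_C, h0, h1, h2]
    field_simp
    ring

theorem derivative_linePoly (f : MvPolynomial (Fin d) ℝ) (b z : Fin d → ℝ) :
    (linePoly f b z).derivative = ∑ i, Polynomial.C (b i) * linePoly (pderiv i f) b z := by
  induction f using MvPolynomial.induction_on with
  | C a => simp [linePoly]
  | add p q hp hq =>
    simp only [linePoly, map_add, mul_add, Finset.sum_add_distrib] at *
    rw [hp, hq]
  | mul_X p i hp =>
    simp only [linePoly, map_mul, Polynomial.derivative_mul, Derivation.leibniz, pderiv_X,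
      smul_eq_mul, map_add] at *
    rw [hp]
    simp only [mul_add, Finset.sum_add_distrib, aeval_X, Finset.sum_mul, Polynomial.derivative_add,
      Polynomial.derivative_C, zero_add, Polynomial.derivative_C_mul, Polynomial.derivative_X,
      mul_one]
    have h1 (x : Fin d) : Polynomial.C (b x) * (aeval (fun i => Polynomial.C (z i) +
        Polynomial.C (b i) * Polynomial.X) p * aeval (fun i => Polynomial.C (z i) +
        Polynomial.C (b i) * Polynomial.X) (Pi.single (M := fun _ => MvPolynomial (Fin d) ℝ) x 1 i)) =
        if x = i then Polynomial.C (b x) * aeval (fun i => Polynomial.C (z i) +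
        Polynomial.C (b i) * Polynomial.X) p else 0 := by
      rcases eq_or_ne x i with rfl | h
      · simp
      · simp [h]
    simp only [h1, Finset.sum_ite_eq', Finset.mem_univ, if_true]
    rw [add_comm]
    congr 1
    · ring
    · rw [← Finset.sum_add_distrib]
      exact Finset.sum_congr rfl fun _ _ => by ring

end Positivity

/-! ### The gradient map on affine subspaces -/

section Gradient

open scoped Topology

variable {d p k : ℕ} {f : MvPolynomial (Fin d) ℝ} {τ : Fin d → ℝ}

/-- The parametrization of an affine subspace by a base point and a family of directions. -/
def affineParam (a : Fin d → ℝ) (w : Fin k → Fin d → ℝ) (t : Fin k → ℝ) : Fin d → ℝ :=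
  a + ∑ j, t j • w j

theorem affineParam_zero (a : Fin d → ℝ) (w : Fin k → Fin d → ℝ) : affineParam a w 0 = a := by
  simp [affineParam]

theorem affineParam_smul (a : Fin d → ℝ) (w : Fin k → Fin d → ℝ) (s : ℝ) (c : Fin k → ℝ) :
    affineParam a w (s • c) = a + s • ∑ j, c j • w j := by
  simp [affineParam, Finset.smul_sum, smul_smul]

theorem continuous_affineParam (a : Fin d → ℝ) (w : Fin k → Fin d → ℝ) :
    Continuous (affineParam a w) := by
  unfold affineParam
  fun_prop

/-- The gradient map on an affine subspace, projected to the dual of the space of directions. -/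
noncomputable def projectedGradient (f : MvPolynomial (Fin d) ℝ) (a : Fin d → ℝ)
    (w : Fin k → Fin d → ℝ) (t : Fin k → ℝ) : Fin k → ℝ :=
  fun j => ∑ i, w j i * gradientMap f (affineParam a w t) i

theorem isOpen_hyperbolicityCone (f : MvPolynomial (Fin d) ℝ) (τ : Fin d → ℝ) :
    IsOpen (hyperbolicityCone f τ) :=
  (isOpen_ne_fun (MvPolynomial.continuous_eval f) continuous_const).connectedComponentIn

theorem contDiffAt_projectedGradient {a : Fin d → ℝ} (ha : eval a f ≠ 0)
    (w : Fin k → Fin d → ℝ) : ContDiffAt ℝ 1 (projectedGradient f a w) 0 := by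
  have hpoly (q : MvPolynomial (Fin d) ℝ) :
      ContDiffAt ℝ 1 (fun t => eval (affineParam a w t) q) 0 := by
    have : AnalyticAt ℝ (fun t => aeval (affineParam a w t) q) 0 := by
      refine AnalyticAt.aeval_mvPolynomial (fun i => ?_) q
      have : ContDiff ℝ ⊤ fun t : Fin k → ℝ => affineParam a w t i := by
        simp only [affineParam, Pi.add_apply, Finset.sum_apply, Pi.smul_apply, smul_eq_mul]
        fun_prop
      exact this.contDiffAt.analyticAt
    simpa only [aeval_eq_eval] using this.contDiffAt
  refine contDiffAt_pi.2 fun j => ?_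
  refine ContDiffAt.sum fun i _ => contDiffAt_const.mul ?_
  refine ((hpoly _).div (hpoly f) ?_).neg
  rwa [affineParam_zero]

theorem sum_mul_gradientMap (b z : Fin d → ℝ) (t : ℝ) :
    ∑ i, b i * gradientMap f (z + t • b) i =
      -((linePoly f b z).derivative.eval t / (linePoly f b z).eval t) := by
  rw [derivative_linePoly, Polynomial.eval_finsetSum, Finset.sum_div, ← Finset.sum_neg_distrib]
  refine Finset.sum_congr rfl fun i _ => ?_
  rw [Polynomial.eval_mul, Polynomial.eval_C, eval_linePoly, eval_linePoly, gradientMap]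
  ring

/-- The projected gradient map is a local homeomorphism. -/
theorem IsHyperbolic.map_nhds_projectedGradient (hf : IsHyperbolic f p τ)
    (hcomplete : IsComplete f τ) {a : Fin d → ℝ} (ha : a ∈ hyperbolicityCone f τ)
    {w : Fin k → Fin d → ℝ} (hw : LinearIndependent ℝ w) :
    Filter.map (projectedGradient f a w) (𝓝 0) = 𝓝 (projectedGradient f a w 0) := by
  have ha0 : eval a f ≠ 0 := connectedComponentIn_subset _ _ ha
  have hstrict := (contDiffAt_projectedGradient ha0 w).hasStrictFDerivAt one_ne_zero
  refine hstrict.map_nhds_eq_of_surj ?_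
  -- Pairing `D c` with `c` gives the second derivative of `-log f` along `∑ j, c j • w j`, which is
  -- positive for `c ≠ 0`. So `D` is injective, hence surjective by equality of dimensions.
  set D := fderiv ℝ (projectedGradient f a w) 0
  have hinj : Function.Injective D.toLinearMap := by
    rw [injective_iff_map_eq_zero]
    intro c hc
    by_contra hc0
    have hwc : ∑ j, c j • w j ≠ 0 := fun h =>
      hc0 (funext fun j => Fintype.linearIndependent_iff.1 hw c h j)
    obtain ⟨e, he, hderiv⟩ := hf.exists_hasDerivAt_pos hcomplete ha hwc
    have hline : HasDerivAt (fun s : ℝ => s • c) c 0 := by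
      simpa using (hasDerivAt_id (0 : ℝ)).smul_const c
    have h1 : HasDerivAt (fun s : ℝ => projectedGradient f a w (s • c)) (D c) 0 := by
      have h0 : HasFDerivAt (projectedGradient f a w) D ((0 : ℝ) • c) := by
        rw [zero_smul]
        exact hstrict.hasFDerivAt
      exact h0.comp_hasDerivAt 0 hline
    rw [show D c = 0 from hc] at h1
    have h2 : HasDerivAt (fun s : ℝ => ∑ j, c j * projectedGradient f a w (s • c) j)
        (∑ j, c j * (0 : Fin k → ℝ) j) 0 :=
      HasDerivAt.fun_sum fun j _ => ((hasDerivAt_pi.1 h1) j).const_mul (c j)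
    have h3 : (fun s : ℝ => ∑ j, c j * projectedGradient f a w (s • c) j) = fun s =>
        -((linePoly f (∑ j, c j • w j) a).derivative.eval s /
          (linePoly f (∑ j, c j • w j) a).eval s) := by
      funext s
      rw [← sum_mul_gradientMap]
      simp only [projectedGradient, affineParam_smul, Finset.mul_sum, Finset.sum_apply,
        Pi.smul_apply, smul_eq_mul, Finset.sum_mul, mul_assoc]
      exact Finset.sum_comm
    rw [h3] at h2
    have := hderiv.unique h2
    simp at this
    exact he.ne' this
  exact LinearMap.range_eq_top.2 (LinearMap.injective_iff_surjective.1 hinj)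

variable {K : Type} [Field K] [Algebra ℝ K]

/-- Extension of scalars of a real vector. -/
def baseChange (K : Type) [Field K] [Algebra ℝ K] (v : Fin d → ℝ) : Fin d → K :=
  fun i => algebraMap ℝ K (v i)

theorem eval_baseChange (g : MvPolynomial (Fin d) ℝ) (v : Fin d → ℝ) :
    eval (baseChange K v) (map (algebraMap ℝ K) g) = algebraMap ℝ K (eval v g) :=
  (MvPolynomial.eval_map ..).trans (MvPolynomial.eval₂_comp _ _ _).symm

/-- A polynomial that vanishes on a neighbourhood of a real point is zero. -/
theorem eq_zero_of_mem_nhds {g : MvPolynomial (Fin k) K} {y : Fin k → ℝ} {N : Set (Fin k → ℝ)}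
    (hN : N ∈ 𝓝 y) (h : ∀ x ∈ N, eval (baseChange K x) g = 0) : g = 0 := by
  obtain ⟨ε, hε, hball⟩ := Metric.mem_nhds_iff.1 hN
  refine funext_set (fun j => algebraMap ℝ K '' Metric.ball (y j) ε) (fun j => ?_) fun x hx => ?_
  · refine Set.Infinite.image (algebraMap ℝ K).injective.injOn ?_
    rw [Real.ball_eq_Ioo]
    exact Set.Ioo_infinite (by linarith)
  · choose z hz hzx using fun j => hx j (Set.mem_univ j)
    rw [map_zero, ← h z (hball ?_)]
    · congr 2
      exact funext fun j => (hzx j).symm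
    · rw [ball_pi _ hε]
      exact fun j _ => hz j

/-- The image of an affine section of the cone under the gradient map, over an extension field. -/
noncomputable def gradientImage (K : Type) [Field K] [Algebra ℝ K]
    (f : MvPolynomial (Fin d) ℝ) (τ a : Fin d → ℝ) (w : Fin k → Fin d → ℝ) : Set (Fin d → K) :=
  (fun t => baseChange K (gradientMap f (affineParam a w t))) ''
    {t | affineParam a w t ∈ hyperbolicityCone f τ}

/-- Substitution of the parametrization of an affine subspace into a polynomial. -/
noncomputable def substParam (K : Type) [Field K] [Algebra ℝ K] (a : Fin d → ℝ)
    (w : Fin k → Fin d → ℝ) (q : MvPolynomial (Fin d) ℝ) : MvPolynomial (Fin k) K :=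
  map (algebraMap ℝ K) (aeval (fun i => C (a i) + ∑ j, C (w j i) * X j) q)

theorem eval_substParam (a : Fin d → ℝ) (w : Fin k → Fin d → ℝ) (q : MvPolynomial (Fin d) ℝ)
    (t : Fin k → ℝ) :
    eval (baseChange K t) (substParam K a w q) = algebraMap ℝ K (eval (affineParam a w t) q) := by
  rw [substParam, eval_baseChange]
  congr 1
  rw [← aeval_eq_eval, ← aeval_eq_eval]
  change ((aeval t).comp (aeval _)) q = _
  rw [comp_aeval]
  congr 2
  funext i
  simp [affineParam, mul_comm]


theorem affineParam_preimage_mem_nhds {a : Fin d → ℝ} (ha : a ∈ hyperbolicityCone f τ)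
    (w : Fin k → Fin d → ℝ) : {t | affineParam a w t ∈ hyperbolicityCone f τ} ∈ 𝓝 0 := by
  refine ((isOpen_hyperbolicityCone f τ).preimage (continuous_affineParam a w)).mem_nhds ?_
  change affineParam a w 0 ∈ hyperbolicityCone f τ
  rwa [affineParam_zero]

theorem substParam_ne_zero {a : Fin d → ℝ} (ha : a ∈ hyperbolicityCone f τ)
    (w : Fin k → Fin d → ℝ) : substParam K a w f ≠ 0 := by
  have ha0 : eval a f ≠ 0 := connectedComponentIn_subset _ _ ha
  intro h
  have h1 := eval_substParam (K := K) a w f 0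
  rw [h, map_zero, affineParam_zero] at h1
  exact ha0 ((map_eq_zero _).1 h1.symm)

/-- The ideal of the image of an affine section of the cone under the gradient map is the kernel of
a homomorphism into a localized polynomial ring. -/
theorem exists_ker_eq_vanishingIdeal {a : Fin d → ℝ} (ha : a ∈ hyperbolicityCone f τ)
    (w : Fin k → Fin d → ℝ) :
    ∃ φ : MvPolynomial (Fin d) K →ₐ[K] Localization.Away (substParam K a w f),
      RingHom.ker φ = vanishingIdeal K (gradientImage K f τ a w) := by
  set r := substParam K a w f
  let φ : MvPolynomial (Fin d) K →ₐ[K] Localization.Away r := aeval fun i =>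
    -(algebraMap _ _ (substParam K a w (pderiv i f)) * IsLocalization.Away.invSelf (S := Localization.Away r) r)
  have hunit {t : Fin k → ℝ} (ht : affineParam a w t ∈ hyperbolicityCone f τ) :
      IsUnit (eval (baseChange K t) r) := by
    rw [isUnit_iff_ne_zero, eval_substParam]
    have : eval (affineParam a w t) f ≠ 0 := connectedComponentIn_subset _ _ ht
    exact (map_ne_zero _).2 this
  have heval {t : Fin k → ℝ} (ht : affineParam a w t ∈ hyperbolicityCone f τ)
      (g : MvPolynomial (Fin d) K) :
      IsLocalization.Away.lift (S := Localization.Away r) r (hunit ht) (φ g) =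
        eval (baseChange K (gradientMap f (affineParam a w t))) g := by
    have hinv : IsLocalization.Away.lift r (hunit ht) (IsLocalization.Away.invSelf (S := Localization.Away r) r) =
        (eval (baseChange K t) r)⁻¹ := by
      refine eq_inv_of_mul_eq_one_right ?_
      rw [← IsLocalization.Away.lift_eq (S := Localization.Away r) r (hunit ht), ← map_mul,
        IsLocalization.Away.mul_invSelf, map_one]
    induction g using MvPolynomial.induction_on with
    | C c =>
      rw [eval_C, show φ (C c) = algebraMap _ _ (C c : MvPolynomial (Fin k) K) from
        φ.commutes c, IsLocalization.Away.lift_eq, eval_C]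
    | add q q' hq hq' => rw [map_add, map_add, map_add, hq, hq']
    | mul_X q i hq =>
      rw [map_mul, map_mul, map_mul, hq, eval_X, aeval_X, map_neg, map_mul,
        IsLocalization.Away.lift_eq, hinv, eval_substParam, eval_substParam]
      simp [baseChange, gradientMap, div_eq_mul_inv]
  refine ⟨φ, ?_⟩
  ext g
  rw [RingHom.mem_ker, mem_vanishingIdeal_iff]
  constructor
  · rintro hg _ ⟨t, ht, rfl⟩
    have := heval ht g
    rw [aeval_eq_eval]
    rw [show φ g = 0 from hg, map_zero] at this
    exact this.symm
  · intro hg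
    obtain ⟨n, q, hq⟩ := IsLocalization.Away.surj r (φ g)
    -- The numerator `q` of `φ g` vanishes at every real parameter near 0, where `g` vanishes on the
    -- gradient image.
    have hq0 : q = 0 := by
      refine eq_zero_of_mem_nhds (affineParam_preimage_mem_nhds ha w) fun t ht => ?_
      rw [← IsLocalization.Away.lift_eq (S := Localization.Away r) r (hunit ht), ← hq, map_mul,
        heval ht]
      have := hg _ ⟨t, ht, rfl⟩
      rw [aeval_eq_eval] at this
      exact mul_eq_zero_of_left this _
    rw [hq0, map_zero] at hq
    exact ((IsLocalization.Away.algebraMap_isUnit r).pow n).mul_left_eq_zero.1 hq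

theorem isPrime_vanishingIdeal_gradientImage {a : Fin d → ℝ} (ha : a ∈ hyperbolicityCone f τ)
    (w : Fin k → Fin d → ℝ) : (vanishingIdeal K (gradientImage K f τ a w)).IsPrime := by
  obtain ⟨φ, hφ⟩ := exists_ker_eq_vanishingIdeal (K := K) ha w
  have : IsDomain (Localization.Away (substParam K a w f)) :=
    IsLocalization.isDomain_localization
      (powers_le_nonZeroDivisors_of_noZeroDivisors (substParam_ne_zero ha w))
  rw [← hφ]
  exact RingHom.ker_isPrime φ

/-- The lower bound uses the linear forms with coefficient vectors `w j`. On the image they are the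
coordinates of `projectedGradient`, whose values fill a neighbourhood, so no nonzero polynomial
relation holds among them. -/
theorem IsHyperbolic.coordTrdeg_gradientImage (hf : IsHyperbolic f p τ)
    (hcomplete : IsComplete f τ) {a : Fin d → ℝ} (ha : a ∈ hyperbolicityCone f τ)
    {w : Fin k → Fin d → ℝ} (hw : LinearIndependent ℝ w) :
    coordTrdeg (vanishingIdeal K (gradientImage K f τ a w)) = k := by
  have := isPrime_vanishingIdeal_gradientImage (K := K) ha w
  apply le_antisymm
  · obtain ⟨φ, hφ⟩ := exists_ker_eq_vanishingIdeal (K := K) ha w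
    exact coordTrdeg_le _ (substParam_ne_zero ha w) φ hφ
  · refine le_coordTrdeg (fun j => ∑ i, C (algebraMap ℝ K (w j i)) * X i) fun g hg => ?_
    have hN := hf.map_nhds_projectedGradient hcomplete ha hw ▸
      Filter.image_mem_map (affineParam_preimage_mem_nhds ha w)
    refine eq_zero_of_mem_nhds hN ?_
    rintro _ ⟨t, ht, rfl⟩
    have := (mem_vanishingIdeal_iff.1 hg) _ ⟨t, ht, rfl⟩
    rw [← AlgHom.comp_apply, comp_aeval, aeval_eq_eval] at this
    rw [← this]
    congr 2
    funext j
    simp [projectedGradient, baseChange]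

end Gradient

/-! ### The dimension of exponential varieties -/

section Main

variable {d p k : ℕ} {f : MvPolynomial (Fin d) ℝ} {τ : Fin d → ℝ}

/-- The affine subspace through `a` in the directions `w`. -/
def affineSection (a : Fin d → ℝ) (w : Fin k → Fin d → ℝ) : Set (Fin d → ℝ) :=
  {θ | θ - a ∈ Submodule.span ℝ (Set.range w)}

theorem gradientImage_eq (K : Type) [Field K] [Algebra ℝ K] (a : Fin d → ℝ)
    (w : Fin k → Fin d → ℝ) :
    gradientImage K f τ a w =
      baseChange K '' (gradientMap f '' (hyperbolicityCone f τ ∩ affineSection a w)) := by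
  ext y
  constructor
  · rintro ⟨t, ht, rfl⟩
    refine ⟨_, ⟨affineParam a w t, ⟨ht, ?_⟩, rfl⟩, rfl⟩
    exact (Submodule.mem_span_range_iff_exists_fun ℝ).2 ⟨t, by simp [affineParam]⟩
  · rintro ⟨_, ⟨θ, ⟨hθ, hw⟩, rfl⟩, rfl⟩
    obtain ⟨t, ht⟩ := (Submodule.mem_span_range_iff_exists_fun ℝ).1 hw
    have h1 : affineParam a w t = θ := by rw [affineParam, ht, add_sub_cancel]
    rw [← h1] at hθ
    exact ⟨t, hθ, by simp only [h1]⟩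

theorem affineSection_castLE_mono (a : Fin d → ℝ) (w : Fin k → Fin d → ℝ) {m n : ℕ} (hmn : m ≤ n)
    (hn : n ≤ k) : affineSection a (w ∘ Fin.castLE (hmn.trans hn)) ⊆
      affineSection a (w ∘ Fin.castLE hn) := by
  refine fun θ hθ => Submodule.span_mono ?_ hθ
  rintro _ ⟨i, rfl⟩
  exact ⟨Fin.castLE hmn i, rfl⟩

theorem affineSection_eq {L : Submodule ℝ (Fin d → ℝ)} {a : Fin d → ℝ} (ha : a ∈ L)
    {w : Fin k → Fin d → ℝ} (hw : Submodule.span ℝ (Set.range w) = L) :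
    affineSection a w = L := by
  ext θ
  rw [affineSection, hw]
  exact L.sub_mem_iff_left ha

theorem exists_linearIndependent_span_eq {L : Submodule ℝ (Fin d → ℝ)} {w : Fin k → L}
    (hw : LinearIndependent ℝ w) (hk : k = Module.finrank ℝ L) :
    LinearIndependent ℝ (fun j => (w j : Fin d → ℝ)) ∧
      Submodule.span ℝ (Set.range fun j => (w j : Fin d → ℝ)) = L := by
  refine ⟨hw.map' L.subtype L.ker_subtype, ?_⟩
  have := hw.span_eq_top_of_card_eq_finrank' ((Fintype.card_fin k).trans hk)
  rw [show (fun j => (w j : Fin d → ℝ)) = L.subtype ∘ w from rfl, Set.range_comp,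
    ← Submodule.map_span, this, Submodule.map_top, Submodule.range_subtype]

/-- The chain comes from the sections through `a` spanned by the first `j` vectors of a basis of
`L`. It starts at the single point `a` and ends at `L`, since `a ∈ L`. -/
theorem dimension_affineExpVariety (hf : IsHyperbolic f p τ) (hcomplete : IsComplete f τ)
    {L : Submodule ℝ (Fin d → ℝ)} {a : Fin d → ℝ} (ha : a ∈ hyperbolicityCone f τ) (haL : a ∈ L) :
    dimension (affineZariski ℝ d) (affineExpVariety f τ L) = Module.finrank ℝ L := by
  obtain ⟨hw, hspan⟩ := exists_linearIndependent_span_eq (Module.finBasis ℝ L).linearIndependent rfl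
  set w : Fin (Module.finrank ℝ L) → Fin d → ℝ := fun j => (Module.finBasis ℝ L j : Fin d → ℝ)
  have himage {m : ℕ} (hm : m ≤ Module.finrank ℝ L) :
      gradientMap f '' (hyperbolicityCone f τ ∩ affineSection a (w ∘ Fin.castLE hm)) =
        gradientImage ℝ f τ a (w ∘ Fin.castLE hm) := by
    rw [gradientImage_eq]
    exact (Set.image_id _).symm
  have key := dimension_closure_eq_of_chain (affineZariski ℝ d) isInducing_affinePoint
    (c := 0) (m := Module.finrank ℝ L) (fun _ => Nat.zero_le _)
    (fun j => gradientMap f '' (hyperbolicityCone f τ ∩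
      affineSection a (w ∘ Fin.castLE (Nat.lt_succ_iff.1 j.2))))
    (fun i j hij => Set.image_mono (Set.inter_subset_inter_right _
      (affineSection_castLE_mono a w hij _)))
    (fun j => by
      rw [vanishingIdeal_affinePoint, himage]
      exact isPrime_vanishingIdeal_gradientImage ha _)
    (fun j => by
      rw [vanishingIdeal_affinePoint, himage]
      exact hf.coordTrdeg_gradientImage hcomplete ha
        (hw.comp _ (Fin.castLE_injective _)))
  have hlast : affineSection a (w ∘ Fin.castLE le_rfl) = L := affineSection_eq haL hspan
  simp only [Fin.val_last] at key
  rw [hlast] at key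
  exact key

theorem mem_projPoint_mk {K : Type} [Field K] {v : Fin d → K} (hv : v ≠ 0)
    {g : MvPolynomial (Fin d) K} :
    g ∈ (projPoint (Projectivization.mk K v hv)).asIdeal ↔ restrictLine v g = 0 := by
  obtain ⟨c, hc⟩ := Projectivization.exists_smul_eq_mk_rep K v hv
  rw [mem_projPoint, Polynomial.ext_iff]
  refine forall_congr' fun n => ?_
  rw [coeff_restrictLine, Polynomial.coeff_zero, ← hc, Units.smul_def,
    eval_smul_of_isHomogeneous (homogeneousComponent_isHomogeneous n g),
    mul_eq_zero_iff_left (pow_ne_zero _ c.ne_zero)]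

/-- A polynomial vanishing on a set stable under positive scaling has infinitely many zeros on each
complex line through a point of the set, so it vanishes on these lines. -/
theorem vanishingIdeal_projPoint {S : Set (Fin d → ℝ)} (h0 : ∀ x ∈ S, x ≠ 0)
    (hsmul : ∀ x ∈ S, ∀ c : ℝ, 0 < c → c • x ∈ S) :
    PrimeSpectrum.vanishingIdeal (projPoint '' toComplexProj S) =
      MvPolynomial.vanishingIdeal ℂ (baseChange ℂ '' S) := by
  ext g
  rw [PrimeSpectrum.mem_vanishingIdeal, mem_vanishingIdeal_iff]
  constructor
  · rintro hg _ ⟨x, hx, rfl⟩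
    have hx0 : baseChange ℂ x ≠ 0 := fun h => h0 x hx (funext fun i =>
      Complex.ofReal_eq_zero.1 (congrFun h i))
    have := (mem_projPoint_mk hx0).1 (hg _ ⟨_, ⟨x, hx, hx0, rfl⟩, rfl⟩)
    rw [aeval_eq_eval, ← one_smul ℂ (baseChange ℂ x), ← eval_restrictLine, this,
      Polynomial.eval_zero]
  · rintro hg _ ⟨_, ⟨x, hx, hx0, rfl⟩, rfl⟩
    refine (mem_projPoint_mk hx0).2 (Polynomial.eq_zero_of_infinite_isRoot _ ?_)
    refine ((Set.Ioi_infinite (0 : ℝ)).image Complex.ofReal_injective.injOn).mono ?_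
    rintro _ ⟨c, hc, rfl⟩
    have := hg _ ⟨_, hsmul x hx c hc, rfl⟩
    rw [aeval_eq_eval] at this
    refine (eval_restrictLine _ _ _).trans (Eq.trans ?_ this)
    refine congrArg (fun v => eval v g) (funext fun i => ?_)
    simp [baseChange]

theorem gradientMap_smul (hf : f.IsHomogeneous p) (hp : p ≠ 0) (θ : Fin d → ℝ) {c : ℝ}
    (hc : c ≠ 0) : gradientMap f (c • θ) = c⁻¹ • gradientMap f θ := by
  funext i
  obtain ⟨n, rfl⟩ := Nat.exists_eq_succ_of_ne_zero hp
  simp only [gradientMap, Pi.smul_apply, smul_eq_mul]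
  rw [eval_smul_of_isHomogeneous hf, eval_smul_of_isHomogeneous hf.pderiv, Nat.succ_sub_one,
    pow_succ, mul_assoc, mul_div_mul_left _ _ (pow_ne_zero _ hc), mul_neg, div_mul_eq_div_div,
    div_right_comm, div_eq_inv_mul _ c, ← mul_div_assoc]

theorem gradientMap_ne_zero (hf : f.IsHomogeneous p) (hp : p ≠ 0) {θ : Fin d → ℝ}
    (hθ : eval θ f ≠ 0) : gradientMap f θ ≠ 0 := by
  intro h
  have hpd (i : Fin d) : eval θ (pderiv i f) = 0 := by
    have := congrFun h i
    simpa [gradientMap, hθ] using this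
  have := congrArg (eval θ) hf.sum_X_mul_pderiv
  rw [map_sum, Finset.sum_eq_zero fun i _ => by rw [map_mul, hpd, mul_zero], nsmul_eq_mul, map_mul,
    map_natCast] at this
  exact mul_ne_zero (Nat.cast_ne_zero.2 hp) hθ this.symm

/-- A nonzero constant `f` vanishes on no line, so completeness would make every vector zero. -/
theorem degree_ne_zero (hf : f.IsHomogeneous p) (hcomplete : IsComplete f τ) (hd : 0 < d)
    {a : Fin d → ℝ} (ha : a ∈ hyperbolicityCone f τ) : p ≠ 0 := by
  rintro rfl
  have ha0 : eval a f ≠ 0 := connectedComponentIn_subset _ _ ha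
  have hconst (x : Fin d → ℝ) : eval x f = eval 0 f := by
    have := eval_smul_of_isHomogeneous hf 0 x
    rwa [zero_smul, pow_zero, one_mul, eq_comm] at this
  have := eq_zero_of_forall_eval_add_smul_ne_zero hf hcomplete ha (w := fun _ => 1) fun t => by
    rwa [hconst, ← hconst a]
  exact one_ne_zero (congrFun this ⟨0, hd⟩)

theorem exists_linearIndependent_first {V : Type} [AddCommGroup V] [Module ℝ V]
    {v : V} (hv : v ≠ 0) {m : ℕ} (hm : m + 1 ≤ Module.finrank ℝ V) :
    ∃ w : Fin (m + 1) → V, LinearIndependent ℝ w ∧ w 0 = v := by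
  induction m with
  | zero =>
    have : Subsingleton (Fin (0 + 1)) := inferInstanceAs (Subsingleton (Fin 1))
    exact ⟨fun _ => v, LinearIndependent.of_subsingleton 0 hv, rfl⟩
  | succ m ih =>
    obtain ⟨w, hw, h0⟩ := ih (Nat.le_of_succ_le hm)
    obtain ⟨x, hx⟩ := exists_linearIndependent_snoc_of_lt_finrank hw hm
    refine ⟨_, hx, ?_⟩
    rw [← h0]
    exact Fin.snoc_castSucc (α := fun _ => V) x w 0

theorem dimension_projExpVariety (hf : IsHyperbolic f p τ) (hcomplete : IsComplete f τ)
    {L : Submodule ℝ (Fin d → ℝ)} {a : Fin d → ℝ} (ha : a ∈ hyperbolicityCone f τ) (haL : a ∈ L)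
    (hd : 0 < d) :
    dimension (projZariski ℂ d) (projExpVariety f τ L) + 1 = Module.finrank ℝ L := by
  have hp : p ≠ 0 := degree_ne_zero hf.homogeneous hcomplete hd ha
  have hne {θ : Fin d → ℝ} (hθ : θ ∈ hyperbolicityCone f τ) : eval θ f ≠ 0 :=
    connectedComponentIn_subset _ _ hθ
  have ha0 : (⟨a, haL⟩ : L) ≠ 0 := by
    intro h
    have h1 : a = 0 := congrArg Subtype.val h
    have h2 := eval_smul_of_isHomogeneous hf.homogeneous 0 a
    rw [zero_smul, zero_pow hp, zero_mul, ← h1] at h2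
    exact hne ha h2
  obtain ⟨m, hm⟩ : ∃ m, Module.finrank ℝ L = m + 1 := Nat.exists_eq_succ_of_ne_zero
    (Module.finrank_pos_iff_exists_ne_zero.2 ⟨_, ha0⟩).ne'
  -- With `a` as first basis vector, the sections spanned by the first `j + 1` vectors are linear
  -- subspaces. Their gradient images are then stable under positive scaling, since the gradient map
  -- is homogeneous of degree `-1`. The flag starts at the line of `a`, which matches the offset `c
  -- = 1`.
  obtain ⟨u, hu, hu0⟩ := exists_linearIndependent_first ha0 hm.ge
  obtain ⟨hw, hspan⟩ := exists_linearIndependent_span_eq hu hm.symm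
  set w : Fin (m + 1) → Fin d → ℝ := fun j => (u j : Fin d → ℝ)
  have hw0 : w 0 = a := congrArg Subtype.val hu0
  have hideal (j : Fin (m + 1)) :
      PrimeSpectrum.vanishingIdeal (projPoint '' toComplexProj (gradientMap f ''
        (hyperbolicityCone f τ ∩ affineSection a (w ∘ Fin.castLE (Nat.succ_le_of_lt j.2))))) =
      MvPolynomial.vanishingIdeal ℂ
        (gradientImage ℂ f τ a (w ∘ Fin.castLE (Nat.succ_le_of_lt j.2))) := by
    rw [gradientImage_eq]
    have hmem : a ∈ Submodule.span ℝ (Set.range (w ∘ Fin.castLE (Nat.succ_le_of_lt j.2))) :=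
      Submodule.subset_span ⟨0, hw0⟩
    refine vanishingIdeal_projPoint ?_ ?_
    · rintro _ ⟨θ, ⟨hθ, -⟩, rfl⟩
      exact gradientMap_ne_zero hf.homogeneous hp (hne hθ)
    · rintro _ ⟨θ, ⟨hθ, hs⟩, rfl⟩ c hc
      refine ⟨c⁻¹ • θ, ⟨smul_mem_hyperbolicityCone hf.homogeneous hθ (inv_pos.2 hc), ?_⟩, ?_⟩
      · rw [affineSection_eq hmem rfl] at hs ⊢
        exact Submodule.smul_mem _ _ hs
      · rw [gradientMap_smul hf.homogeneous hp _ (inv_ne_zero hc.ne'), inv_inv]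
  have key := dimension_closure_eq_of_chain (projZariski ℂ d) isInducing_projPoint
    (c := 1) (m := m) one_le_coordTrdeg_projPoint
    (fun j => toComplexProj (gradientMap f '' (hyperbolicityCone f τ ∩
      affineSection a (w ∘ Fin.castLE (Nat.succ_le_of_lt j.2)))))
    (fun i j hij => by
      rintro _ ⟨x, hx, hx0, rfl⟩
      exact ⟨x, Set.image_mono (Set.inter_subset_inter_right _
        (affineSection_castLE_mono a w (Nat.succ_le_succ hij) _)) hx, hx0, rfl⟩)
    (fun j => by
      rw [hideal]
      exact isPrime_vanishingIdeal_gradientImage ha _)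
    (fun j => by
      rw [hideal]
      exact hf.coordTrdeg_gradientImage hcomplete ha (hw.comp _ (Fin.castLE_injective _)))
  have hlast : affineSection a (w ∘ Fin.castLE le_rfl) = L := affineSection_eq haL hspan
  simp only [Fin.val_last] at key
  rw [hlast] at key
  rw [hm]
  exact congrArg (· + 1) key

end Main

end ExpVar

theorem mainTheorem10 {d p : ℕ} (f : MvPolynomial (Fin d) ℝ) (τ : Fin d → ℝ)
    (hf : ExpVar.IsHyperbolic f p τ) (hcomplete : ExpVar.IsComplete f τ)
    (L : Submodule ℝ (Fin d → ℝ))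
    (hL : (ExpVar.hyperbolicityCone f τ ∩ (L : Set (Fin d → ℝ))).Nonempty) :
    ExpVar.dimension (ExpVar.affineZariski ℝ d) (ExpVar.affineExpVariety f τ L) =
        (Module.finrank ℝ L : WithBot ℕ∞) ∧
      (0 < d →
        ExpVar.dimension (ExpVar.projZariski ℂ d) (ExpVar.projExpVariety f τ L) + 1 =
          (Module.finrank ℝ L : WithBot ℕ∞)) := by
  obtain ⟨a, ha, haL⟩ := hL
  exact ⟨ExpVar.dimension_affineExpVariety hf hcomplete ha haL,
    ExpVar.dimension_projExpVariety hf hcomplete ha haL⟩
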